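/- Let $n\ge 2$ and let $G^+_{\mathbb R}(2,n)$ be the Grassmannian of oriented planes in $\mathbb R^n$, i.e. the space of orthonormal pairs $(v_1,v_2)$ of vectors in $\mathbb R^n$ modulo the right action of $\mathrm{SO}_2$, with the quotient topology. Let $T\subset \mathrm{SO}_n$ be a maximal torus, acting on $G^+_{\mathbb R}(2,n)$ by $A\cdot[(v_1,v_2)]=[(Av_1,Av_2)]$. Then the orbit space $G^+_{\mathbb R}(2,n)/T$, with the quotient topology, is homeomorphic to the topological join \[ S^{\lfloor n/2\rfloor-1} * \mathbb{CP}^{\lceil n/2\rceil-2}. \] Here $S^{k-1}$ is the unit sphere in $\mathbb R^k$, and for non-empty spaces $X,Y$ the join $X*Y$ is the quotient of $X\times Y\times[0,1]$ by the equivalence relation generated by $(x,y,0)\sim(x',y,0)$ and $(x,y,1)\sim(x,y',1)$; moreover $X*\emptyset=X$, and $\mathbb{CP}^{-1}=\emptyset$ (which occurs only for $n=2$). -/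

import Mathlib

open Matrix

/-! ### The oriented Grassmannian of planes -/

/-- Pairs `(v₁, v₂)` of vectors of `ℝⁿ` with `⟨vᵢ, vⱼ⟩ = δᵢⱼ`, written as the `n × 2` matrices with
orthonormal columns, with the subspace topology. -/
def OrthonormalPair (n : ℕ) : Type :=
  {V : Matrix (Fin n) (Fin 2) ℝ // Vᵀ * V = 1}

instance (n : ℕ) : TopologicalSpace (OrthonormalPair n) :=
  inferInstanceAs (TopologicalSpace {V : Matrix (Fin n) (Fin 2) ℝ // Vᵀ * V = 1})

/-- Two orthonormal pairs span the same oriented plane iff they differ by a rotation: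
`(w₁, w₂) = (v₁, v₂) Q` with `Q ∈ SO₂`. -/
def sameOrientedPlane (n : ℕ) : Setoid (OrthonormalPair n) where
  r V W := ∃ Q ∈ specialOrthogonalGroup (Fin 2) ℝ, W.1 = V.1 * Q
  iseqv :=
    { refl := fun V => ⟨1, one_mem _, by simp⟩
      symm := by
        rintro V W ⟨Q, hQ, h⟩
        let q : specialOrthogonalGroup (Fin 2) ℝ := ⟨Q, hQ⟩
        refine ⟨(q⁻¹).1, (q⁻¹).2, ?_⟩
        have hq : Q * (q⁻¹).1 = 1 := congrArg Subtype.val (mul_inv_cancel q)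
        rw [h, Matrix.mul_assoc, hq, Matrix.mul_one]
      trans := by
        rintro U V W ⟨Q, hQ, h⟩ ⟨R, hR, h'⟩
        exact ⟨Q * R, mul_mem hQ hR, by rw [h', h, Matrix.mul_assoc]⟩ }

/-- The Grassmannian of oriented planes in `ℝⁿ`: orthonormal pairs modulo `SO₂`,
with the quotient topology. -/
def OrientedGrassmannian (n : ℕ) : Type :=
  Quotient (sameOrientedPlane n)

instance (n : ℕ) : TopologicalSpace (OrientedGrassmannian n) :=
  inferInstanceAs (TopologicalSpace (Quotient (sameOrientedPlane n)))

/-- `SOₙ` acts on orthonormal pairs by `A • (v₁, v₂) = (A v₁, A v₂)`. -/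
instance (n : ℕ) : MulAction (specialOrthogonalGroup (Fin n) ℝ) (OrthonormalPair n) where
  smul A V := ⟨A.1 * V.1, by
    have hA : A.1ᵀ * A.1 = 1 :=
      (mem_orthogonalGroup_iff' (Fin n) ℝ).1 (mem_specialOrthogonalGroup_iff.1 A.2).1
    rw [Matrix.transpose_mul, Matrix.mul_assoc, ← Matrix.mul_assoc A.1ᵀ, hA, Matrix.one_mul, V.2]⟩
  one_smul V := Subtype.ext (Matrix.one_mul V.1)
  mul_smul A B V := Subtype.ext (Matrix.mul_assoc A.1 B.1 V.1)

/-- The induced action of `SOₙ` on oriented planes. -/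
instance (n : ℕ) : MulAction (specialOrthogonalGroup (Fin n) ℝ) (OrientedGrassmannian n) where
  smul A := Quotient.map (A • ·) (by
    rintro V W ⟨Q, hQ, h⟩
    refine ⟨Q, hQ, ?_⟩
    change A.1 * W.1 = A.1 * V.1 * Q
    rw [h, Matrix.mul_assoc])
  one_smul := by
    rintro ⟨V⟩
    exact congrArg (Quotient.mk (sameOrientedPlane n)) (one_smul _ V)
  mul_smul A B := by
    rintro ⟨V⟩
    exact congrArg (Quotient.mk (sameOrientedPlane n)) (mul_smul A B V)

/-! ### Maximal tori -/

/-- A subgroup is a torus if, as a topological group, it is isomorphic to some `(S¹)ᵏ`. -/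
def IsTorus {G : Type*} [Group G] [TopologicalSpace G] (H : Subgroup G) : Prop :=
  ∃ k : ℕ, Nonempty (H ≃ₜ* (Fin k → Circle))

/-- A maximal torus: a torus that is not properly contained in another one. -/
def IsMaximalTorus {G : Type*} [Group G] [TopologicalSpace G] (T : Subgroup G) : Prop :=
  Maximal IsTorus T

/-! ### Complex projective space and the topological join -/

/-- The complex projective space of lines in `ℂᴺ`, i.e. `ℂℙᴺ⁻¹` (empty for `N = 0`),
with the quotient topology from `ℂᴺ ∖ {0}`. -/
def ComplexProjectiveSpace (N : ℕ) : Type :=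
  Projectivization ℂ (Fin N → ℂ)

instance (N : ℕ) : TopologicalSpace (ComplexProjectiveSpace N) :=
  inferInstanceAs (TopologicalSpace (Quotient (projectivizationSetoid ℂ (Fin N → ℂ))))

/-- The gluing relation of the join: the end `t = 0` of the cylinder `X × Y × [0, 1]` is projected
to `Y` and the end `t = 1` is projected to `X`. -/
inductive JoinRel (X Y : Type*) :
    X ⊕ Y ⊕ (X × Y × unitInterval) → X ⊕ Y ⊕ (X × Y × unitInterval) → Prop
  | zero (x : X) (y : Y) : JoinRel X Y (.inr (.inr (x, y, 0))) (.inr (.inl y))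
  | one (x : X) (y : Y) : JoinRel X Y (.inr (.inr (x, y, 1))) (.inl x)

/-- The topological join `X * Y`, with the quotient topology. If `X` and `Y` are non-empty, this is
the quotient of `X × Y × [0, 1]` by `(x, y, 0) ∼ (x', y, 0)` and `(x, y, 1) ∼ (x, y', 1)`;
keeping the two summands `X` and `Y` gives the usual convention `X * ∅ = X`, `∅ * Y = Y`. -/
def Join (X Y : Type*) : Type _ :=
  Quot (JoinRel X Y)

instance (X Y : Type*) [TopologicalSpace X] [TopologicalSpace Y] : TopologicalSpace (Join X Y) :=
  inferInstanceAs (TopologicalSpace (Quot (JoinRel X Y)))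

/-- A family of commuting endomorphisms has a common eigenvector in every nonzero invariant
subspace. -/
theorem exists_common_eigenvector {V : Type*} [AddCommGroup V] [Module ℂ V]
    [FiniteDimensional ℂ V] (F : Set (Module.End ℂ V)) (hF : ∀ f ∈ F, ∀ g ∈ F, Commute f g)
    (S : Submodule ℂ V) (hS : S ≠ ⊥) (hinv : ∀ f ∈ F, ∀ x ∈ S, f x ∈ S) :
    ∃ z ∈ S, z ≠ 0 ∧ ∀ f ∈ F, ∃ χ : ℂ, f z = χ • z := by
  obtain ⟨P, ⟨hP0, hPS, hPinv⟩, hmin⟩ := (wellFounded_lt (α := Submodule ℂ V)).has_min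
    {P | P ≠ ⊥ ∧ P ≤ S ∧ ∀ f ∈ F, ∀ x ∈ P, f x ∈ P} ⟨S, hS, le_rfl, hinv⟩
  obtain ⟨z, hzP, hz0⟩ := P.exists_mem_ne_zero_of_ne_bot hP0
  refine ⟨z, hPS hzP, hz0, fun f hf => ?_⟩
  have : Nontrivial P := ⟨⟨⟨z, hzP⟩, 0, fun h => hz0 (congrArg Subtype.val h)⟩⟩
  obtain ⟨μ, hμ⟩ := Module.End.exists_eigenvalue (f.restrict (hPinv f hf))
  obtain ⟨x, hx⟩ := hμ.exists_hasEigenvector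
  have hfx : f x.1 = μ • x.1 := congrArg Subtype.val hx.apply_eq_smul
  have hle : P ⊓ Module.End.eigenspace f μ = P := by
    by_contra hne
    refine hmin _ ⟨?_, inf_le_left.trans hPS, ?_⟩ (lt_of_le_of_ne inf_le_left hne)
    · intro hb
      have : x.1 ∈ P ⊓ Module.End.eigenspace f μ := ⟨x.2, Module.End.mem_eigenspace_iff.2 hfx⟩
      rw [hb, Submodule.mem_bot] at this
      exact hx.2 (Subtype.ext this)
    · rintro g hg y ⟨hy, hy'⟩
      refine ⟨hPinv g hg y hy, Module.End.mem_eigenspace_iff.2 ?_⟩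
      have h1 : f (g y) = g (f y) := LinearMap.congr_fun (hF f hf g hg).eq y
      rw [h1, Module.End.mem_eigenspace_iff.1 hy', map_smul]
  rw [← hle] at hzP
  exact ⟨μ, Module.End.mem_eigenspace_iff.1 hzP.2⟩

/-- The complex vectors whose real and imaginary parts lie in a given real subspace. -/
def complexSpan {n : ℕ} (W : Submodule ℝ (Fin n → ℝ)) : Submodule ℂ (Fin n → ℂ) where
  carrier := {z | (fun i => (z i).re) ∈ W ∧ (fun i => (z i).im) ∈ W}
  add_mem' := by
    rintro x y ⟨hx, hx'⟩ ⟨hy, hy'⟩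
    exact ⟨W.add_mem hx hy, W.add_mem hx' hy'⟩
  zero_mem' := ⟨W.zero_mem, W.zero_mem⟩
  smul_mem' := by
    rintro c x ⟨hx, hx'⟩
    constructor
    · convert W.sub_mem (W.smul_mem c.re hx) (W.smul_mem c.im hx') using 1
      ext i
      simp
    · convert W.add_mem (W.smul_mem c.re hx') (W.smul_mem c.im hx) using 1
      ext i
      simp

theorem re_map_mulVec {n : ℕ} (B : Matrix (Fin n) (Fin n) ℝ) (z : Fin n → ℂ) :
    (fun i => ((B.map (algebraMap ℝ ℂ) *ᵥ z) i).re) = B *ᵥ fun i => (z i).re := by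
  ext i
  simp [mulVec, dotProduct]

theorem im_map_mulVec {n : ℕ} (B : Matrix (Fin n) (Fin n) ℝ) (z : Fin n → ℂ) :
    (fun i => ((B.map (algebraMap ℝ ℂ) *ᵥ z) i).im) = B *ᵥ fun i => (z i).im := by
  ext i
  simp [mulVec, dotProduct]

section CommutingDivisible

variable {n : ℕ} {T : Subgroup (specialOrthogonalGroup (Fin n) ℝ)}

theorem transpose_mul_self_of_so (A : specialOrthogonalGroup (Fin n) ℝ) : A.1ᵀ * A.1 = 1 :=
  (mem_orthogonalGroup_iff' (Fin n) ℝ).1 (mem_specialOrthogonalGroup_iff.1 A.2).1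

theorem mulVec_dotProduct_mulVec_so (A : specialOrthogonalGroup (Fin n) ℝ) (x y : Fin n → ℝ) :
    (A.1 *ᵥ x) ⬝ᵥ (A.1 *ᵥ y) = x ⬝ᵥ y := by
  rw [dotProduct_mulVec, vecMul_mulVec, transpose_mul_self_of_so, vecMul_one]

theorem mulVec_inv_mulVec_so (A : specialOrthogonalGroup (Fin n) ℝ) (x : Fin n → ℝ) :
    A.1 *ᵥ (A⁻¹.1 *ᵥ x) = x := by
  have h : A.1 * A⁻¹.1 = 1 := congrArg Subtype.val (mul_inv_cancel A)
  rw [mulVec_mulVec, h, one_mulVec]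

/-- A commuting divisible group of rotations acts trivially on an invariant subspace,
or it rotates some pair of orthonormal vectors of that subspace. -/
theorem trivial_or_exists_rotated_pair
    (hcomm : ∀ A ∈ T, ∀ B ∈ T, A * B = B * A) (hdiv : ∀ A ∈ T, ∃ C ∈ T, C * C = A)
    (W : Submodule ℝ (Fin n → ℝ)) (hW : ∀ A ∈ T, ∀ x ∈ W, A.1 *ᵥ x ∈ W) :
    (∀ A ∈ T, ∀ x ∈ W, A.1 *ᵥ x = x) ∨
    ∃ u ∈ W, ∃ v ∈ W, u ⬝ᵥ u = 1 ∧ v ⬝ᵥ v = 1 ∧ u ⬝ᵥ v = 0 ∧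
      ∀ A ∈ T, ∃ a b : ℝ, A.1 *ᵥ u = a • u + b • v ∧ A.1 *ᵥ v = -b • u + a • v := by
  let W₁ : Submodule ℝ (Fin n → ℝ) :=
    { carrier := {x | x ∈ W ∧ ∀ y, (∀ A ∈ T, A.1 *ᵥ y = y) → y ⬝ᵥ x = 0}
      add_mem' := by
        rintro x y ⟨hx, hx'⟩ ⟨hy, hy'⟩
        exact ⟨W.add_mem hx hy, fun z hz => by rw [dotProduct_add, hx' z hz, hy' z hz, add_zero]⟩
      zero_mem' := ⟨W.zero_mem, fun z _ => dotProduct_zero z⟩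
      smul_mem' := by
        rintro c x ⟨hx, hx'⟩
        exact ⟨W.smul_mem c hx, fun z hz => by rw [dotProduct_smul, hx' z hz, smul_zero]⟩ }
  have hfix : ∀ A ∈ T, ∀ y, (∀ B ∈ T, B.1 *ᵥ y = y) → ∀ x, y ⬝ᵥ (A.1 *ᵥ x) = y ⬝ᵥ x := by
    intro A hA y hy x
    conv_lhs => rw [← hy A hA]
    exact mulVec_dotProduct_mulVec_so A y x
  have hW₁ : ∀ A ∈ T, ∀ x ∈ W₁, A.1 *ᵥ x ∈ W₁ := by
    rintro A hA x ⟨hx, hx'⟩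
    exact ⟨hW A hA x hx, fun y hy => by rw [hfix A hA y hy, hx' y hy]⟩
  by_cases hbot : W₁ = ⊥
  · left
    intro A hA x hx
    have : A.1 *ᵥ x - x ∈ W₁ := ⟨W.sub_mem (hW A hA x hx) hx, fun y hy => by
      rw [dotProduct_sub, hfix A hA y hy, sub_self]⟩
    rw [hbot, Submodule.mem_bot] at this
    exact sub_eq_zero.1 this
  right
  obtain ⟨z, hz, hz0, hχ⟩ := exists_common_eigenvector
    ((fun A : specialOrthogonalGroup (Fin n) ℝ => (A.1.map (algebraMap ℝ ℂ)).mulVecLin) '' T)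
    (by
      rintro _ ⟨A, hA, rfl⟩ _ ⟨B, hB, rfl⟩
      have h : A.1 * B.1 = B.1 * A.1 := congrArg Subtype.val (hcomm A hA B hB)
      change mulVecLin _ * mulVecLin _ = mulVecLin _ * mulVecLin _
      rw [Module.End.mul_eq_comp, Module.End.mul_eq_comp, ← mulVecLin_mul, ← mulVecLin_mul,
        ← Matrix.map_mul, ← Matrix.map_mul, h])
    (complexSpan W₁)
    (by
      intro h
      obtain ⟨x, hx, hx0⟩ := W₁.exists_mem_ne_zero_of_ne_bot hbot
      have : (fun i => (x i : ℂ)) ∈ complexSpan W₁ := ⟨by simpa using hx, W₁.zero_mem⟩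
      rw [h, Submodule.mem_bot] at this
      exact hx0 (funext fun i => by simpa using congrFun this i))
    (by
      rintro _ ⟨A, hA, rfl⟩ x ⟨hx, hx'⟩
      refine ⟨?_, ?_⟩
      · have := hW₁ A hA _ hx
        rw [← re_map_mulVec] at this
        exact this
      · have := hW₁ A hA _ hx'
        rw [← im_map_mulVec] at this
        exact this)
  set x : Fin n → ℝ := fun i => (z i).re with hxdef
  set y : Fin n → ℝ := fun i => (z i).im with hydef
  obtain ⟨hx, hy⟩ : x ∈ W₁ ∧ y ∈ W₁ := hz
  have hAz : ∀ A ∈ T, ∃ χ : ℂ, A.1 *ᵥ x = χ.re • x - χ.im • y ∧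
      A.1 *ᵥ y = χ.im • x + χ.re • y := by
    intro A hA
    obtain ⟨χ, h⟩ := hχ _ ⟨A, hA, rfl⟩
    simp only [mulVecLin_apply] at h
    refine ⟨χ, ?_, ?_⟩
    · rw [hxdef, ← re_map_mulVec, h]; ext i; simp [hydef]
    · rw [hydef, ← im_map_mulVec, h]; ext i; simp [hxdef]; ring
  have hxy : x ≠ 0 ∨ y ≠ 0 := by
    by_contra! h
    exact hz0 (funext fun i => Complex.ext (congrFun h.1 i) (congrFun h.2 i))
  choose! χ hχx hχy using hAz
  have hζ : ∀ A ∈ T, ((χ A) ^ 2 - 1) * (⟨x ⬝ᵥ x - y ⬝ᵥ y, 2 * (x ⬝ᵥ y)⟩ : ℂ) = 0 := by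
    intro A hA
    have h1 := mulVec_dotProduct_mulVec_so A x x
    have h2 := mulVec_dotProduct_mulVec_so A y y
    have h3 := mulVec_dotProduct_mulVec_so A x y
    rw [hχx A hA] at h1 h3
    rw [hχy A hA] at h2 h3
    simp only [dotProduct_add, dotProduct_sub, add_dotProduct, sub_dotProduct, dotProduct_smul,
      smul_dotProduct, smul_eq_mul, dotProduct_comm y x] at h1 h2 h3
    apply Complex.ext
    · simp [pow_two]
      linear_combination h1 - h2
    · simp [pow_two]
      linear_combination 2 * h3
  have hsq : ∃ A ∈ T, (χ A) ^ 2 - 1 ≠ 0 := by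
    by_contra! h
    have hx1 : ∀ A ∈ T, A.1 *ᵥ x = x ∧ A.1 *ᵥ y = y := by
      intro A hA
      obtain ⟨C, hC, rfl⟩ := hdiv A hA
      have e : (C * C).1 = C.1 * C.1 := rfl
      have h' := h C hC
      have h1 := congrArg Complex.re h'
      have h2 := congrArg Complex.im h'
      simp [pow_two] at h1 h2
      rw [e, ← mulVec_mulVec, ← mulVec_mulVec, hχx C hC, hχy C hC, mulVec_sub, mulVec_add]
      simp only [mulVec_smul, hχx C hC, hχy C hC]
      constructor
      · ext i
        simp
        linear_combination (x i) * h1 - (y i) * h2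
      · ext i
        simp
        linear_combination (y i) * h1 + (x i) * h2
    rcases hxy with h0 | h0
    · exact h0 (dotProduct_self_eq_zero.1 (hx.2 x fun A hA => (hx1 A hA).1))
    · exact h0 (dotProduct_self_eq_zero.1 (hy.2 y fun A hA => (hx1 A hA).2))
  obtain ⟨A, hA, hne⟩ := hsq
  have h0 := (mul_eq_zero.1 (hζ A hA)).resolve_left hne
  have hxx : x ⬝ᵥ x = y ⬝ᵥ y := sub_eq_zero.1 (congrArg Complex.re h0)
  have hxy0 : x ⬝ᵥ y = 0 := by
    have := congrArg Complex.im h0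
    simpa using this
  have hpos : 0 < x ⬝ᵥ x := by
    have hnn : ∀ w : Fin n → ℝ, 0 ≤ w ⬝ᵥ w := fun w => Finset.sum_nonneg fun i _ =>
      mul_self_nonneg _
    rcases hxy with h | h
    · exact lt_of_le_of_ne (hnn x) fun e => h (dotProduct_self_eq_zero.1 e.symm)
    · rw [hxx]
      exact lt_of_le_of_ne (hnn y) fun e => h (dotProduct_self_eq_zero.1 e.symm)
  set s := (Real.sqrt (x ⬝ᵥ x))⁻¹ with hs
  have hss : s * (s * (x ⬝ᵥ x)) = 1 := by
    have h1 : Real.sqrt (x ⬝ᵥ x) ≠ 0 := (Real.sqrt_pos.2 hpos).ne'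
    have h2 := Real.mul_self_sqrt hpos.le
    rw [hs]
    field_simp
    rw [pow_two, h2]
  refine ⟨s • x, W.smul_mem _ hx.1, s • y, W.smul_mem _ hy.1, ?_, ?_, ?_, fun B hB =>
    ⟨(χ B).re, -(χ B).im, ?_, ?_⟩⟩
  · simpa [smul_dotProduct, dotProduct_smul] using hss
  · simpa [smul_dotProduct, dotProduct_smul, ← hxx] using hss
  · simp [smul_dotProduct, dotProduct_smul, hxy0]
  · rw [mulVec_smul, hχx B hB]; ext i; simp; ring
  · rw [mulVec_smul, hχy B hB]; ext i; simp; ring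

end CommutingDivisible

theorem exists_unit_orthogonal {ι : Type*} [Fintype ι] {n : ℕ} (f : ι → Fin n → ℝ)
    (h : Fintype.card ι < n) : ∃ x : Fin n → ℝ, x ⬝ᵥ x = 1 ∧ ∀ i, f i ⬝ᵥ x = 0 := by
  have hker : LinearMap.ker (Matrix.mulVecLin (Matrix.of f)) ≠ ⊥ :=
    LinearMap.ker_ne_bot_of_finrank_lt (by simpa using h)
  obtain ⟨x, hx, hx0⟩ := Submodule.exists_mem_ne_zero_of_ne_bot hker
  have hpos : 0 < x ⬝ᵥ x := lt_of_le_of_ne (Finset.sum_nonneg fun i _ => mul_self_nonneg _)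
    fun e => hx0 (dotProduct_self_eq_zero.1 e.symm)
  refine ⟨(Real.sqrt (x ⬝ᵥ x))⁻¹ • x, ?_, fun i => ?_⟩
  · have h1 : Real.sqrt (x ⬝ᵥ x) ≠ 0 := (Real.sqrt_pos.2 hpos).ne'
    have h2 := Real.mul_self_sqrt hpos.le
    rw [smul_dotProduct, dotProduct_smul, smul_eq_mul, smul_eq_mul]
    field_simp
    rw [pow_two, h2]
  · have : f i ⬝ᵥ x = 0 := congrFun (LinearMap.mem_ker.1 hx) i
    rw [dotProduct_smul, this, smul_zero]

theorem exists_rotated_family {n : ℕ} {T : Subgroup (specialOrthogonalGroup (Fin n) ℝ)}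
    (hcomm : ∀ A ∈ T, ∀ B ∈ T, A * B = B * A) (hdiv : ∀ A ∈ T, ∃ C ∈ T, C * C = A)
    (j : ℕ) (hj : 2 * j ≤ n) :
    ∃ u v : Fin j → Fin n → ℝ, (∀ i l, u i ⬝ᵥ u l = if i = l then 1 else 0) ∧
      (∀ i l, v i ⬝ᵥ v l = if i = l then 1 else 0) ∧ (∀ i l, u i ⬝ᵥ v l = 0) ∧
      ∀ A ∈ T, ∀ i, ∃ a b : ℝ,
        A.1 *ᵥ u i = a • u i + b • v i ∧ A.1 *ᵥ v i = -b • u i + a • v i := by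
  induction j with
  | zero => exact ⟨fun _ => 0, fun _ => 0, fun i => i.elim0, fun i => i.elim0, fun i => i.elim0,
      fun _ _ i => i.elim0⟩
  | succ j ih =>
    obtain ⟨u, v, huu, hvv, huv, hT⟩ := ih (by omega)
    let W : Submodule ℝ (Fin n → ℝ) :=
      { carrier := {x | ∀ i, u i ⬝ᵥ x = 0 ∧ v i ⬝ᵥ x = 0}
        add_mem' := fun {x y} hx hy i => by
          simp [dotProduct_add, (hx i).1, (hx i).2, (hy i).1, (hy i).2]
        zero_mem' := fun i => by simp
        smul_mem' := fun c x hx i => by simp [dotProduct_smul, (hx i).1, (hx i).2] }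
    have hW : ∀ A ∈ T, ∀ x ∈ W, A.1 *ᵥ x ∈ W := by
      intro A hA x hx i
      obtain ⟨a, b, h1, h2⟩ := hT A⁻¹ (T.inv_mem hA) i
      constructor
      · rw [← mulVec_inv_mulVec_so A (u i), mulVec_dotProduct_mulVec_so, h1]
        simp [add_dotProduct, (hx i).1, (hx i).2]
      · rw [← mulVec_inv_mulVec_so A (v i), mulVec_dotProduct_mulVec_so, h2]
        simp [add_dotProduct, (hx i).1, (hx i).2]
    obtain ⟨x, hx, y, hy, hxx, hyy, hxy, hrot⟩ : ∃ x ∈ W, ∃ y ∈ W,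
        x ⬝ᵥ x = 1 ∧ y ⬝ᵥ y = 1 ∧ x ⬝ᵥ y = 0 ∧
        ∀ A ∈ T, ∃ a b : ℝ, A.1 *ᵥ x = a • x + b • y ∧ A.1 *ᵥ y = -b • x + a • y := by
      rcases trivial_or_exists_rotated_pair hcomm hdiv W hW with htriv | h
      · obtain ⟨x, hxx, hx⟩ := exists_unit_orthogonal (Sum.elim u v) (by simp; omega)
        obtain ⟨y, hyy, hy⟩ := exists_unit_orthogonal
          (Sum.elim (Sum.elim u v) fun _ : Unit => x) (by simp; omega)
        have hxW : x ∈ W := fun i => ⟨hx (.inl i), hx (.inr i)⟩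
        have hyW : y ∈ W := fun i => ⟨hy (.inl (.inl i)), hy (.inl (.inr i))⟩
        refine ⟨x, hxW, y, hyW, hxx, hyy, hy (.inr ()), fun A hA => ⟨1, 0, ?_, ?_⟩⟩
        · rw [htriv A hA x hxW]; simp
        · rw [htriv A hA y hyW]; simp
      · exact h
    refine ⟨Fin.cons x u, Fin.cons y v, ?_, ?_, ?_, ?_⟩
    · intro i l
      cases i using Fin.cases <;> cases l using Fin.cases <;>
        simp [hxx, huu, (hx _).1, dotProduct_comm x, eq_comm]
    · intro i l
      cases i using Fin.cases <;> cases l using Fin.cases <;>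
        simp [hyy, hvv, (hy _).2, dotProduct_comm y, eq_comm]
    · intro i l
      cases i using Fin.cases <;> cases l using Fin.cases <;>
        simp [hxy, huv, (hy _).1, (hx _).2, dotProduct_comm x (v _)]
    · intro A hA i
      cases i using Fin.cases with
      | zero => simpa using hrot A hA
      | succ i => simpa using hT A hA i

/-- The matrix of multiplication by a unit complex number. -/
def rotationMatrix (z : Circle) : Matrix (Fin 2) (Fin 2) ℝ :=
  !![(z : ℂ).re, -(z : ℂ).im; (z : ℂ).im, (z : ℂ).re]

/-- The block diagonal matrix of `k` planar rotations, followed by an identity block. -/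
def torusMatrix {k : ℕ} (r : ℕ) (t : Fin k → Circle) :
    Matrix (Fin 2 × Fin k ⊕ Fin r) (Fin 2 × Fin k ⊕ Fin r) ℝ :=
  fromBlocks (blockDiagonal fun j => rotationMatrix (t j)) 0 0 1

theorem rotationMatrix_mul (z w : Circle) :
    rotationMatrix (z * w) = rotationMatrix z * rotationMatrix w := by
  ext i j
  fin_cases i <;> fin_cases j <;> simp [rotationMatrix] <;> ring

theorem rotationMatrix_one : rotationMatrix 1 = 1 := by
  ext i j
  fin_cases i <;> fin_cases j <;> simp [rotationMatrix]

theorem circle_re_mul_self_add (z : Circle) :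
    (z : ℂ).re * (z : ℂ).re + (z : ℂ).im * (z : ℂ).im = 1 := by
  have := Circle.normSq_coe z
  rwa [Complex.normSq_apply] at this

theorem rotationMatrix_transpose_mul (z : Circle) :
    (rotationMatrix z)ᵀ * rotationMatrix z = 1 := by
  have h := circle_re_mul_self_add z
  ext i j
  fin_cases i <;> fin_cases j <;> simp [rotationMatrix, mul_apply] <;> linarith

theorem det_rotationMatrix (z : Circle) : (rotationMatrix z).det = 1 := by
  have h := circle_re_mul_self_add z
  rw [rotationMatrix, det_fin_two_of]
  linarith

section torusMatrix

variable {k r : ℕ}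

theorem torusMatrix_mul (s t : Fin k → Circle) :
    torusMatrix r (s * t) = torusMatrix r s * torusMatrix r t := by
  simp [torusMatrix, fromBlocks_multiply, ← blockDiagonal_mul, rotationMatrix_mul]

theorem torusMatrix_one : torusMatrix r (1 : Fin k → Circle) = 1 := by
  have : (fun _ : Fin k => (1 : Matrix (Fin 2) (Fin 2) ℝ)) = 1 := rfl
  simp [torusMatrix, rotationMatrix_one, this]

theorem torusMatrix_transpose_mul (t : Fin k → Circle) :
    (torusMatrix r t)ᵀ * torusMatrix r t = 1 := by
  have : (fun _ : Fin k => (1 : Matrix (Fin 2) (Fin 2) ℝ)) = 1 := rfl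
  simp [torusMatrix, fromBlocks_transpose, blockDiagonal_transpose, fromBlocks_multiply,
    ← blockDiagonal_mul, rotationMatrix_transpose_mul, this]

theorem det_torusMatrix (t : Fin k → Circle) :
    (torusMatrix r t).det = 1 := by
  simp [torusMatrix, det_blockDiagonal, det_rotationMatrix]

theorem continuous_torusMatrix :
    Continuous (torusMatrix (k := k) r) := by
  have h : Continuous rotationMatrix := by
    refine continuous_matrix fun i j => ?_
    fin_cases i <;> fin_cases j <;> simp [rotationMatrix] <;> fun_prop
  refine Continuous.matrix_fromBlocks ?_ continuous_const continuous_const continuous_const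
  refine Continuous.matrix_blockDiagonal (continuous_pi fun j => h.comp (continuous_apply j))

theorem torusMatrix_injective :
    Function.Injective (torusMatrix (k := k) r) := by
  intro s t h
  ext j
  have h0 := congrFun (congrFun h (.inl (0, j))) (.inl (0, j))
  have h1 := congrFun (congrFun h (.inl (1, j))) (.inl (0, j))
  simp [torusMatrix, rotationMatrix] at h0 h1
  exact Complex.ext h0 h1

end torusMatrix

/-- The standard maximal torus with respect to the orthonormal basis given by the columns
of `g`. -/
def torusHom {n k r : ℕ} (g : Matrix (Fin n) (Fin 2 × Fin k ⊕ Fin r) ℝ) (hg : gᵀ * g = 1)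
    (hg' : g * gᵀ = 1) : (Fin k → Circle) →* specialOrthogonalGroup (Fin n) ℝ where
  toFun t := ⟨g * torusMatrix r t * gᵀ, by
    rw [mem_specialOrthogonalGroup_iff, mem_orthogonalGroup_iff']
    constructor
    · simp only [transpose_mul, transpose_transpose, Matrix.mul_assoc]
      rw [← Matrix.mul_assoc gᵀ g, hg, Matrix.one_mul, ← Matrix.mul_assoc _ (torusMatrix r t),
        torusMatrix_transpose_mul, Matrix.one_mul, hg']
    · rw [det_conj_of_mul_eq_one hg' hg, det_torusMatrix]⟩
  map_one' := Subtype.ext (by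
    change g * torusMatrix r 1 * gᵀ = 1
    rw [torusMatrix_one, Matrix.mul_one, hg'])
  map_mul' s t := Subtype.ext (by
    change g * torusMatrix r (s * t) * gᵀ = (g * torusMatrix r s * gᵀ) * (g * torusMatrix r t * gᵀ)
    simp only [torusMatrix_mul, Matrix.mul_assoc]
    rw [← Matrix.mul_assoc gᵀ g, hg, Matrix.one_mul])

theorem isTorus_range_torusHom {n k r : ℕ} (g : Matrix (Fin n) (Fin 2 × Fin k ⊕ Fin r) ℝ)
    (hg : gᵀ * g = 1) (hg' : g * gᵀ = 1) : IsTorus (torusHom g hg hg').range := by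
  have hinj : Function.Injective (torusHom g hg hg') := by
    intro s t h
    have h' : g * torusMatrix r s * gᵀ = g * torusMatrix r t * gᵀ := congrArg Subtype.val h
    have h2 : ∀ t : Fin k → Circle, torusMatrix r t = gᵀ * (g * torusMatrix r t * gᵀ) * g := by
      intro t
      rw [← Matrix.mul_assoc, ← Matrix.mul_assoc, hg, Matrix.one_mul, Matrix.mul_assoc, hg,
        Matrix.mul_one]
    exact torusMatrix_injective (by rw [h2 s, h', ← h2 t])
  have hcont : Continuous (torusHom g hg hg') :=
    Continuous.subtype_mk ((continuous_const.matrix_mul continuous_torusMatrix).matrix_mul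
      continuous_const) _
  let e := MonoidHom.ofInjective hinj
  have he : Continuous e := Continuous.subtype_mk hcont _
  let h := Continuous.homeoOfEquivCompactToT2 (f := e.toEquiv) he
  exact ⟨k, ⟨(ContinuousMulEquiv.mk e he h.symm.continuous).symm⟩⟩

/-- Every maximal torus of `SOₙ` is conjugate to the standard one. -/
theorem IsMaximalTorus.exists_eq_range_torusHom {n : ℕ}
    {T : Subgroup (specialOrthogonalGroup (Fin n) ℝ)} (hT : IsMaximalTorus T) :
    ∃ (g : Matrix (Fin n) (Fin 2 × Fin (n / 2) ⊕ Fin (n % 2)) ℝ) (hg : gᵀ * g = 1)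
      (hg' : g * gᵀ = 1), T = (torusHom g hg hg').range := by
  obtain ⟨k, ⟨e⟩⟩ := hT.prop
  have hcomm : ∀ A ∈ T, ∀ B ∈ T, A * B = B * A := by
    intro A hA B hB
    have : (⟨A, hA⟩ : T) * ⟨B, hB⟩ = ⟨B, hB⟩ * ⟨A, hA⟩ :=
      e.injective (by rw [map_mul, map_mul, mul_comm])
    exact congrArg Subtype.val this
  have hdiv : ∀ A ∈ T, ∃ C ∈ T, C * C = A := by
    intro A hA
    have hsqrt : ∀ z : Circle, ∃ w : Circle, w * w = z := fun z =>
      ⟨Circle.exp (Complex.arg z / 2), by rw [← Circle.exp_add, add_halves, Circle.exp_arg]⟩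
    choose f hf using hsqrt
    let C := e.symm fun i => f (e ⟨A, hA⟩ i)
    have : C * C = ⟨A, hA⟩ := e.injective (by
      rw [map_mul]
      ext i
      simp [C, hf])
    exact ⟨C, C.2, congrArg Subtype.val this⟩
  obtain ⟨u, v, huu, hvv, huv, hrot⟩ := exists_rotated_family hcomm hdiv (n / 2) (by omega)
  obtain ⟨w, hww, hwu, hwv⟩ : ∃ w : Fin (n % 2) → Fin n → ℝ,
      (∀ i l, w i ⬝ᵥ w l = if i = l then 1 else 0) ∧ (∀ i l, u i ⬝ᵥ w l = 0) ∧
      (∀ i l, v i ⬝ᵥ w l = 0) := by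
    rcases Nat.mod_two_eq_zero_or_one n with h | h
    · rw [h]
      exact ⟨fun _ => 0, fun i => i.elim0, fun _ i => i.elim0, fun _ i => i.elim0⟩
    · obtain ⟨x, hxx, hx⟩ := exists_unit_orthogonal (Sum.elim u v) (by simp; omega)
      rw [h]
      exact ⟨fun _ => x, fun i l => by simp [hxx, Subsingleton.elim i l],
        fun i l => hx (.inl i), fun i l => hx (.inr i)⟩
  have : Subsingleton (Fin (n % 2)) := Fin.subsingleton_iff_le_one.2 (by omega)
  let cols : Fin 2 × Fin (n / 2) ⊕ Fin (n % 2) → Fin n → ℝ :=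
    Sum.elim (fun p => ![u p.2, v p.2] p.1) w
  let g : Matrix (Fin n) (Fin 2 × Fin (n / 2) ⊕ Fin (n % 2)) ℝ := (Matrix.of cols)ᵀ
  have hg : gᵀ * g = 1 := by
    ext p q
    change cols p ⬝ᵥ cols q = _
    rcases p with ⟨i, p⟩ | p <;> rcases q with ⟨j, q⟩ | q
    · fin_cases i <;> fin_cases j <;>
        simp [cols, huu, hvv, huv, dotProduct_comm (v _) (u _), Matrix.one_apply]
    · fin_cases i <;> simp [cols, hwu, hwv]
    · fin_cases j <;> simp [cols, dotProduct_comm (w _), hwu, hwv]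
    · simp [cols, hww, Matrix.one_apply]
  have hcard : Fin 2 × Fin (n / 2) ⊕ Fin (n % 2) ≃ Fin n :=
    Fintype.equivFinOfCardEq (by simp; omega)
  have hg' : g * gᵀ = 1 := (mul_eq_one_comm_of_equiv hcard).1 hg
  have hle : T ≤ (torusHom g hg hg').range := by
    intro A hA
    have hz : ∀ i, ∃ z : Circle, A.1 *ᵥ u i = (z : ℂ).re • u i + (z : ℂ).im • v i ∧
        A.1 *ᵥ v i = -(z : ℂ).im • u i + (z : ℂ).re • v i := by
      intro i
      obtain ⟨a, b, h1, h2⟩ := hrot A hA i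
      have h3 := mulVec_dotProduct_mulVec_so A (u i) (u i)
      simp only [h1, dotProduct_add, add_dotProduct, dotProduct_smul, smul_dotProduct, huu, hvv,
        huv, dotProduct_comm (v i) (u i), smul_eq_mul, if_true] at h3
      refine ⟨⟨⟨a, b⟩, mem_sphere_zero_iff_norm.2 ?_⟩, h1, h2⟩
      rw [← sq_eq_sq₀ (norm_nonneg _) zero_le_one, Complex.sq_norm, Complex.normSq_mk]
      linarith
    choose z hzu hzv using hz
    have hexp : ∀ y : Fin n → ℝ, y = ∑ p, (cols p ⬝ᵥ y) • cols p := by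
      intro y
      have : y = g *ᵥ (gᵀ *ᵥ y) := by rw [mulVec_mulVec, hg', one_mulVec]
      conv_lhs => rw [this]
      ext x
      simp only [mulVec, dotProduct, Finset.sum_apply, Pi.smul_apply, smul_eq_mul]
      exact Finset.sum_congr rfl fun p _ => mul_comm _ _
    have hw : ∀ C ∈ T, ∀ l, C.1 *ᵥ w l = (w l ⬝ᵥ C.1 *ᵥ w l) • w l := by
      intro C hC l
      have hi : ∀ i, u i ⬝ᵥ C.1 *ᵥ w l = 0 ∧ v i ⬝ᵥ C.1 *ᵥ w l = 0 := by
        intro i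
        obtain ⟨a, b, h1, h2⟩ := hrot C⁻¹ (T.inv_mem hC) i
        constructor
        · rw [← mulVec_inv_mulVec_so C (u i), mulVec_dotProduct_mulVec_so, h1]
          simp [add_dotProduct, hwu, hwv]
        · rw [← mulVec_inv_mulVec_so C (v i), mulVec_dotProduct_mulVec_so, h2]
          simp [add_dotProduct, hwu, hwv]
      conv_lhs => rw [hexp (C.1 *ᵥ w l)]
      simp [Fintype.sum_sum_type, Fintype.sum_prod_type, cols, hi, Fintype.sum_subsingleton _ l]
    have hwfix : ∀ l, A.1 *ᵥ w l = w l := by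
      intro l
      obtain ⟨C, hC, rfl⟩ := hdiv A hA
      have h1 := hw C hC l
      have h2 := mulVec_dotProduct_mulVec_so C (w l) (w l)
      set μ := w l ⬝ᵥ C.1 *ᵥ w l
      rw [h1] at h2
      simp only [dotProduct_smul, smul_dotProduct, hww, if_true, smul_eq_mul, mul_one] at h2
      have e : (C * C).1 = C.1 * C.1 := rfl
      rw [e, ← mulVec_mulVec, h1, mulVec_smul, h1, smul_smul, h2, one_smul]
    have hAg : A.1 * g = g * torusMatrix (n % 2) z := by
      ext x p
      change (A.1 *ᵥ cols p) x = ∑ q, cols q x * torusMatrix (n % 2) z q p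
      rcases p with ⟨i, p⟩ | p
      · fin_cases i
        · simp [cols, hzu, torusMatrix, Fintype.sum_sum_type, Fintype.sum_prod_type,
            blockDiagonal_apply, rotationMatrix, mul_comm]
        · simp [cols, hzv, torusMatrix, Fintype.sum_sum_type, Fintype.sum_prod_type,
            blockDiagonal_apply, rotationMatrix, mul_comm]
      · simp [cols, hwfix, torusMatrix, Fintype.sum_sum_type, Matrix.one_apply]
    refine ⟨z, Subtype.ext ?_⟩
    change g * torusMatrix (n % 2) z * gᵀ = A.1
    rw [← hAg, Matrix.mul_assoc, hg', Matrix.mul_one]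
  exact ⟨g, hg, hg', hT.eq_of_le (isTorus_range_torusHom g hg hg') hle⟩

section Join

variable {E M Y : Type*} [NormedAddCommGroup E] [NormedSpace ℝ E] [AddCommGroup M] [Module ℝ M]

/-- The map from the join of the unit sphere of `E` with `Y` to `E × M` induced by a map
`φ : Y → M`. -/
def joinMap (φ : Y → M) : Join (Metric.sphere (0 : E) 1) Y → E × M :=
  Quot.lift (Sum.elim (fun x => ((x : E), 0)) (Sum.elim (fun y => (0, φ y))
    (fun p => ((p.2.2 : ℝ) • (p.1 : E), (1 - (p.2.2 : ℝ) ^ 2) • φ p.2.1)))) (by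
      rintro _ _ (⟨x, y⟩ | ⟨x, y⟩) <;> simp)

theorem continuous_joinMap [TopologicalSpace Y] [TopologicalSpace M] [ContinuousSMul ℝ M]
    {φ : Y → M} (hφ : Continuous φ) : Continuous (joinMap (E := E) φ) := by
  refine continuous_quot_lift _ ?_
  refine Continuous.sumElim (by fun_prop) (Continuous.sumElim (by fun_prop) ?_)
  fun_prop

theorem Join.cases_of_sphere {E Y : Type*} [NormedAddCommGroup E]
    {C : Join (Metric.sphere (0 : E) 1) Y → Prop}
    (inl : ∀ x, C (Quot.mk _ (.inl x))) (inr : ∀ y, C (Quot.mk _ (.inr (.inl y))))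
    (mid : ∀ x y (t : unitInterval), 0 < (t : ℝ) → (t : ℝ) < 1 →
      C (Quot.mk _ (.inr (.inr (x, y, t))))) (p : Join (Metric.sphere (0 : E) 1) Y) : C p := by
  induction p using Quot.ind with
  | mk p =>
    rcases p with x | y | ⟨x, y, t⟩
    · exact inl x
    · exact inr y
    · rcases eq_or_ne t 0 with rfl | h0
      · rw [Quot.sound (JoinRel.zero x y)]
        exact inr y
      rcases eq_or_ne t 1 with rfl | h1
      · rw [Quot.sound (JoinRel.one x y)]
        exact inl x
      exact mid x y t (unitInterval.pos_iff_ne_zero.2 h0) (unitInterval.lt_one_iff_ne_one.2 h1)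

theorem joinMap_injective {φ : Y → M} (hφ : Function.Injective φ) :
    Function.Injective (joinMap (E := E) φ) := by
  have hS : ∀ x : Metric.sphere (0 : E) 1, ‖(x : E)‖ = 1 := fun x => norm_eq_of_mem_sphere x
  have hS0 : ∀ x : Metric.sphere (0 : E) 1, (x : E) ≠ 0 := fun x => ne_zero_of_mem_unit_sphere x
  have hnorm : ∀ (x : Metric.sphere (0 : E) 1) (t : unitInterval), ‖(t : ℝ) • (x : E)‖ = t := by
    intro x t
    rw [norm_smul, hS, mul_one, Real.norm_of_nonneg t.2.1]
  intro p q h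
  induction p using Join.cases_of_sphere with
  | inl x =>
    induction q using Join.cases_of_sphere with
    | inl x' => rw [Subtype.ext (congrArg Prod.fst h : (x : E) = x')]
    | inr y' => exact absurd (congrArg Prod.fst h) (hS0 x)
    | mid x' y' t' h0 h1 =>
      have h' : (x : E) = (t' : ℝ) • (x' : E) := congrArg Prod.fst h
      have := hnorm x' t'
      rw [← h', hS] at this
      exact absurd this h1.ne'
  | inr y =>
    induction q using Join.cases_of_sphere with
    | inl x' => exact absurd (congrArg Prod.fst h).symm (hS0 x')
    | inr y' => rw [hφ (congrArg Prod.snd h)]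
    | mid x' y' t' h0 h1 =>
      have h' : (0 : E) = (t' : ℝ) • (x' : E) := congrArg Prod.fst h
      have := hnorm x' t'
      rw [← h', norm_zero] at this
      exact absurd this h0.ne
  | mid x y t h0 h1 =>
    induction q using Join.cases_of_sphere with
    | inl x' =>
      have h' : (t : ℝ) • (x : E) = x' := congrArg Prod.fst h
      have := hnorm x t
      rw [h', hS] at this
      exact absurd this h1.ne'
    | inr y' =>
      have h' : (t : ℝ) • (x : E) = 0 := congrArg Prod.fst h
      have := hnorm x t
      rw [h', norm_zero] at this
      exact absurd this h0.ne
    | mid x' y' t' h0' h1' =>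
      have h2 : (t : ℝ) • (x : E) = (t' : ℝ) • (x' : E) := congrArg Prod.fst h
      have h3 : (1 - (t : ℝ) ^ 2) • φ y = (1 - (t' : ℝ) ^ 2) • φ y' := congrArg Prod.snd h
      have ht : t = t' := Subtype.ext (by rw [← hnorm x t, h2, hnorm])
      subst ht
      have hx : x = x' := Subtype.ext (smul_right_injective E h0.ne' h2)
      have ht1 : 1 - (t : ℝ) ^ 2 ≠ 0 := by nlinarith
      have hy : y = y' := hφ (smul_right_injective M ht1 h3)
      rw [hx, hy]

theorem mem_range_joinMap {φ : Y → M} {p : E × M} : p ∈ Set.range (joinMap (E := E) φ) ↔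
    (‖p.1‖ = 1 ∧ p.2 = 0) ∨ ‖p.1‖ ≤ 1 ∧ ∃ y, p.2 = (1 - ‖p.1‖ ^ 2) • φ y := by
  constructor
  · rintro ⟨q, rfl⟩
    induction q using Quot.ind with
    | mk q =>
      rcases q with x | y | ⟨x, y, t⟩
      · exact .inl ⟨norm_eq_of_mem_sphere x, rfl⟩
      · exact .inr ⟨by simp [joinMap], y, by simp [joinMap]⟩
      · have h : ‖(t : ℝ) • (x : E)‖ = t := by
          rw [norm_smul, norm_eq_of_mem_sphere, mul_one, Real.norm_of_nonneg t.2.1]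
        refine .inr ⟨h.trans_le t.2.2, y, ?_⟩
        change (1 - (t : ℝ) ^ 2) • φ y = (1 - ‖(t : ℝ) • (x : E)‖ ^ 2) • φ y
        rw [h]
  · obtain ⟨x, m⟩ := p
    rintro (⟨h1, h2⟩ | ⟨h1, y, h2⟩)
    · simp only at h1 h2
      subst h2
      exact ⟨Quot.mk _ (.inl ⟨x, mem_sphere_zero_iff_norm.2 h1⟩), rfl⟩
    · simp only at h1 h2
      subst h2
      rcases eq_or_ne x 0 with rfl | hx
      · exact ⟨Quot.mk _ (.inr (.inl y)), by simp [joinMap]⟩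
      · have hx' : ‖x‖ ≠ 0 := norm_ne_zero_iff.2 hx
        refine ⟨Quot.mk _ (.inr (.inr (⟨‖x‖⁻¹ • x, mem_sphere_zero_iff_norm.2 ?_⟩, y,
          ⟨‖x‖, norm_nonneg x, h1⟩))), ?_⟩
        · rw [norm_smul, norm_inv, norm_norm, inv_mul_cancel₀ hx']
        · simp [joinMap, smul_smul, hx']

instance {X Y : Type*} [TopologicalSpace X] [TopologicalSpace Y] [CompactSpace X]
    [CompactSpace Y] : CompactSpace (Join X Y) :=
  inferInstanceAs (CompactSpace (Quot (JoinRel X Y)))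

end Join

instance (N : ℕ) : CompactSpace (ComplexProjectiveSpace N) := by
  let f : Metric.sphere (0 : Fin N → ℂ) 1 → ComplexProjectiveSpace N := fun v =>
    Projectivization.mk ℂ v.1 (ne_zero_of_mem_unit_sphere v)
  have hf : Continuous f := by
    have h : Continuous fun v : Metric.sphere (0 : Fin N → ℂ) 1 =>
        (⟨v.1, ne_zero_of_mem_unit_sphere v⟩ : {v : Fin N → ℂ // v ≠ 0}) :=
      Continuous.subtype_mk continuous_subtype_val _
    exact continuous_quotient_mk'.comp h
  have hsurj : Function.Surjective f := by
    intro p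
    induction p using Projectivization.ind with
    | h v hv =>
      have hv' : ‖v‖ ≠ 0 := norm_ne_zero_iff.2 hv
      refine ⟨⟨((‖v‖ : ℂ)⁻¹) • v, mem_sphere_zero_iff_norm.2 ?_⟩, ?_⟩
      · rw [norm_smul, norm_inv, Complex.norm_real, norm_norm, inv_mul_cancel₀ hv']
      · exact (Projectivization.mk_eq_mk_iff' ℂ _ _ _ _).2 ⟨_, rfl⟩
  exact hsurj.compactSpace hf

section rankOne

variable {ι : Type*}

/-- The Hermitian matrix `c cᴴ`. -/
def rankOne (c : ι → ℂ) : Matrix ι ι ℂ := Matrix.of fun i j => c i * star (c j)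

theorem rankOne_eq_iff {c d : ι → ℂ} :
    rankOne c = rankOne d ↔ ∃ z : Circle, ∀ i, d i = z * c i := by
  constructor
  · intro h
    have hij : ∀ i j, c i * star (c j) = d i * star (d j) := fun i j =>
      congrFun (congrFun h i) j
    have hn : ∀ i, ‖c i‖ = ‖d i‖ := by
      intro i
      have := congrArg norm (hij i i)
      rw [norm_mul, norm_mul, norm_star, norm_star] at this
      exact (mul_self_inj (norm_nonneg _) (norm_nonneg _)).1 this
    by_cases hc : ∀ i, c i = 0
    · refine ⟨1, fun i => ?_⟩
      have := hn i
      rw [hc i, norm_zero, eq_comm, norm_eq_zero] at this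
      simp [this, hc i]
    · push Not at hc
      obtain ⟨l, hl⟩ := hc
      have hz : ‖d l / c l‖ = 1 := by
        rw [norm_div, hn, div_self]
        rw [← hn]
        exact norm_ne_zero_iff.2 hl
      refine ⟨⟨d l / c l, mem_sphere_zero_iff_norm.2 hz⟩, fun i => ?_⟩
      change d i = d l / c l * c i
      have hdl : d l ≠ 0 := norm_ne_zero_iff.1 (by rw [← hn]; exact norm_ne_zero_iff.2 hl)
      have h1 := hij i l
      have h2 := hij l l
      have hs : star (d l) ≠ 0 := star_ne_zero.2 hdl
      have hs' : star (c l) ≠ 0 := star_ne_zero.2 hl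
      field_simp
      apply mul_right_cancel₀ hs
      apply mul_right_cancel₀ hs'
      linear_combination (-(c l * star (c l))) * h1 + (c i * star (c l)) * h2
  · rintro ⟨z, h⟩
    have hz : (z : ℂ) * star (z : ℂ) = 1 := by
      have := Circle.normSq_coe z
      rw [Complex.star_def, Complex.mul_conj, this, Complex.ofReal_one]
    ext i j
    change c i * star (c j) = d i * star (d j)
    rw [h, h, star_mul]
    linear_combination (-(c i * star (c j))) * hz

theorem continuous_rankOne : Continuous (rankOne : (ι → ℂ) → Matrix ι ι ℂ) := by
  refine continuous_matrix fun i j => ?_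
  simp only [rankOne, Matrix.of_apply]
  fun_prop

theorem rankOne_smul (a : ℂ) (c : ι → ℂ) : rankOne (a • c) = Complex.normSq a • rankOne c := by
  ext i j
  simp [rankOne, Complex.normSq_eq_conj_mul_self]
  ring

variable [Fintype ι]

/-- The squared Euclidean norm of a complex vector. -/
def sqNorm (c : ι → ℂ) : ℝ := ∑ i, Complex.normSq (c i)

theorem sqNorm_nonneg (c : ι → ℂ) : 0 ≤ sqNorm c :=
  Finset.sum_nonneg fun _ _ => Complex.normSq_nonneg _

theorem sqNorm_eq_zero {c : ι → ℂ} : sqNorm c = 0 ↔ c = 0 := by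
  rw [sqNorm, Finset.sum_eq_zero_iff_of_nonneg fun _ _ => Complex.normSq_nonneg _, funext_iff]
  simp

theorem sqNorm_pos {c : ι → ℂ} (hc : c ≠ 0) : 0 < sqNorm c :=
  lt_of_le_of_ne (sqNorm_nonneg c) fun h => hc (sqNorm_eq_zero.1 h.symm)

theorem sqNorm_smul (a : ℂ) (c : ι → ℂ) : sqNorm (a • c) = Complex.normSq a * sqNorm c := by
  simp [sqNorm, Finset.mul_sum]

theorem continuous_sqNorm : Continuous (sqNorm : (ι → ℂ) → ℝ) :=
  continuous_finsetSum _ fun i _ => Complex.continuous_normSq.comp (continuous_apply i)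

/-- The orthogonal projection onto the line through `c`. -/
noncomputable def lineProj (c : ι → ℂ) : Matrix ι ι ℂ := (sqNorm c)⁻¹ • rankOne c

theorem lineProj_smul {a : ℂ} (ha : a ≠ 0) (c : ι → ℂ) : lineProj (a • c) = lineProj c := by
  have := Complex.normSq_pos.2 ha
  rw [lineProj, lineProj, sqNorm_smul, rankOne_smul, smul_smul]
  congr 1
  field_simp

theorem lineProj_eq_rankOne (c : ι → ℂ) :
    lineProj c = rankOne (((Real.sqrt (sqNorm c))⁻¹ : ℂ) • c) := by
  rw [rankOne_smul, lineProj, ← Complex.ofReal_inv, Complex.normSq_ofReal, ← mul_inv,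
    Real.mul_self_sqrt (sqNorm_nonneg c)]

theorem exists_smul_eq_of_lineProj_eq {c d : ι → ℂ} (hd : d ≠ 0)
    (h : lineProj c = lineProj d) : ∃ a : ℂ, a • c = d := by
  rw [lineProj_eq_rankOne, lineProj_eq_rankOne, rankOne_eq_iff] at h
  obtain ⟨z, hz⟩ := h
  have hs : (Real.sqrt (sqNorm d) : ℂ) ≠ 0 :=
    Complex.ofReal_ne_zero.2 (Real.sqrt_pos.2 (sqNorm_pos hd)).ne'
  refine ⟨Real.sqrt (sqNorm d) * (z * (Real.sqrt (sqNorm c) : ℂ)⁻¹), funext fun i => ?_⟩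
  have := hz i
  simp only [Pi.smul_apply, smul_eq_mul] at this ⊢
  rw [mul_assoc, mul_assoc, ← this, mul_inv_cancel_left₀ hs]

end rankOne

section projective

variable {ι : Type*} {N : ℕ} {D : Submodule ℂ (ι → ℂ)}

theorem coe_linearEquiv_ne_zero (L : (Fin N → ℂ) ≃ₗ[ℂ] D) {v : Fin N → ℂ} (hv : v ≠ 0) :
    (L v : ι → ℂ) ≠ 0 := fun h => hv (L.map_eq_zero_iff.1 (Subtype.ext h))

variable [Fintype ι]

/-- Embedding of projective space as the projections onto the lines in a subspace `D`. -/
noncomputable def projectiveMap (L : (Fin N → ℂ) ≃ₗ[ℂ] D) : ComplexProjectiveSpace N → Matrix ι ι ℂ :=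
  Projectivization.lift (fun v => lineProj (L v.1 : ι → ℂ)) (by
    rintro ⟨a, ha⟩ ⟨b, hb⟩ t h
    simp only at h
    have ht : t ≠ 0 := by
      rintro rfl
      exact ha (by rw [h, zero_smul])
    simp only [h, map_smul, Submodule.coe_smul]
    exact lineProj_smul ht _)

theorem continuous_projectiveMap (L : (Fin N → ℂ) ≃ₗ[ℂ] D) : Continuous (projectiveMap L) := by
  have hL : Continuous fun v : {v : Fin N → ℂ // v ≠ 0} => (L v.1 : ι → ℂ) :=
    (LinearMap.continuous_of_finiteDimensional (D.subtype ∘ₗ L.toLinearMap)).comp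
      continuous_subtype_val
  refine continuous_quot_lift _ ?_
  exact ((continuous_sqNorm.comp hL).inv₀ fun v =>
    (sqNorm_pos (coe_linearEquiv_ne_zero L v.2)).ne').smul (continuous_rankOne.comp hL)

theorem projectiveMap_injective (L : (Fin N → ℂ) ≃ₗ[ℂ] D) :
    Function.Injective (projectiveMap L) := by
  intro p q h
  induction p using Projectivization.ind with
  | h v hv =>
    induction q using Projectivization.ind with
    | h w hw =>
      have h' : lineProj (L v : ι → ℂ) = lineProj (L w : ι → ℂ) := h
      obtain ⟨a, ha⟩ := exists_smul_eq_of_lineProj_eq (coe_linearEquiv_ne_zero L hv) h'.symm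
      exact (Projectivization.mk_eq_mk_iff' ℂ _ _ _ _).2
        ⟨a, L.injective (Subtype.ext (by rw [map_smul]; exact ha))⟩

theorem range_projectiveMap (L : (Fin N → ℂ) ≃ₗ[ℂ] D) :
    Set.range (projectiveMap L) = lineProj '' {c | c ∈ D ∧ c ≠ 0} := by
  ext P
  constructor
  · rintro ⟨p, rfl⟩
    induction p using Projectivization.ind with
    | h v hv => exact ⟨L v, ⟨(L v).2, coe_linearEquiv_ne_zero L hv⟩, rfl⟩
  · rintro ⟨c, ⟨hcD, hc⟩, rfl⟩
    have h0 : L.symm ⟨c, hcD⟩ ≠ 0 := fun h => hc (congrArg Subtype.val (L.symm.map_eq_zero_iff.1 h))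
    refine ⟨Projectivization.mk ℂ _ h0, ?_⟩
    change lineProj (L (L.symm ⟨c, hcD⟩) : ι → ℂ) = lineProj c
    rw [L.apply_symm_apply]

theorem range_joinMap_projectiveMap {E : Type*} [NormedAddCommGroup E] [NormedSpace ℝ E]
    (L : (Fin N → ℂ) ≃ₗ[ℂ] D) : Set.range (joinMap (E := E) (projectiveMap L)) =
      {p | ∃ c ∈ D, p.2 = rankOne c ∧ ‖p.1‖ ^ 2 + sqNorm c = 1} := by
  have key : ∀ Q, (∃ y, Q = projectiveMap L y) ↔ ∃ c ∈ D, c ≠ 0 ∧ Q = lineProj c := by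
    intro Q
    have := Set.ext_iff.1 (range_projectiveMap L) Q
    simp only [Set.mem_range, Set.mem_image, Set.mem_ofPred_eq] at this
    constructor
    · rintro ⟨y, rfl⟩
      obtain ⟨c, ⟨h1, h2⟩, h3⟩ := this.1 ⟨y, rfl⟩
      exact ⟨c, h1, h2, h3.symm⟩
    · rintro ⟨c, h1, h2, rfl⟩
      obtain ⟨y, hy⟩ := this.2 ⟨c, ⟨h1, h2⟩, rfl⟩
      exact ⟨y, hy.symm⟩
  ext ⟨x, m⟩
  rw [mem_range_joinMap]
  simp only [Set.mem_ofPred_eq]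
  constructor
  · rintro (⟨h1, rfl⟩ | ⟨h1, y, rfl⟩)
    · exact ⟨0, D.zero_mem, by ext; simp [rankOne], by simp [h1, sqNorm_eq_zero]⟩
    · obtain ⟨c, hcD, hc, h⟩ := (key _).1 ⟨y, rfl⟩
      have h2 : 0 ≤ 1 - ‖x‖ ^ 2 := by nlinarith [norm_nonneg x]
      have h3 := sqNorm_pos hc
      refine ⟨(Real.sqrt ((1 - ‖x‖ ^ 2) / sqNorm c) : ℂ) • c, D.smul_mem _ hcD, ?_, ?_⟩
      · rw [h, rankOne_smul, Complex.normSq_ofReal, Real.mul_self_sqrt (by positivity), lineProj,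
          smul_smul]
        rfl
      · rw [sqNorm_smul, Complex.normSq_ofReal, Real.mul_self_sqrt (by positivity)]
        field_simp
        ring
  · rintro ⟨c, hcD, rfl, h⟩
    rcases eq_or_ne c 0 with rfl | hc
    · left
      rw [sqNorm_eq_zero.2 rfl, add_zero] at h
      exact ⟨(pow_eq_one_iff_of_nonneg (norm_nonneg _) two_ne_zero).1 h, by ext; simp [rankOne]⟩
    · right
      have h3 := sqNorm_pos hc
      refine ⟨by nlinarith [norm_nonneg x], ?_⟩
      obtain ⟨y, hy⟩ := (key _).2 ⟨c, hcD, hc, rfl⟩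
      refine ⟨y, ?_⟩
      rw [← hy, lineProj, smul_smul, ← h, add_sub_cancel_left, mul_inv_cancel₀ h3.ne', one_smul]

end projective

/-- Two points of `ℂ²` with the same invariants lie on one orbit of the circle action
`t • (a, b) = (t a, t̄ b)`. -/
theorem exists_circle_of_mul_eq {a b a' b' : ℂ} (h : a * b = a' * b')
    (h' : Complex.normSq a - Complex.normSq b = Complex.normSq a' - Complex.normSq b') :
    ∃ t : Circle, a' = t * a ∧ b' = star (t : ℂ) * b := by
  have hab : Complex.normSq a * Complex.normSq b = Complex.normSq a' * Complex.normSq b' := by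
    rw [← Complex.normSq_mul, h, Complex.normSq_mul]
  have p1 := Complex.normSq_nonneg a
  have p2 := Complex.normSq_nonneg b
  have p3 := Complex.normSq_nonneg a'
  have p4 := Complex.normSq_nonneg b'
  have hsum : Complex.normSq a + Complex.normSq b = Complex.normSq a' + Complex.normSq b' := by
    have : (Complex.normSq a + Complex.normSq b) ^ 2 =
        (Complex.normSq a' + Complex.normSq b') ^ 2 := by
      linear_combination 4 * hab + (Complex.normSq a - Complex.normSq b +
        (Complex.normSq a' - Complex.normSq b')) * h'
    exact (pow_left_inj₀ (by positivity) (by positivity) two_ne_zero).1 this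
  have ha : ‖a‖ = ‖a'‖ := by
    rw [← sq_eq_sq₀ (norm_nonneg _) (norm_nonneg _), Complex.sq_norm, Complex.sq_norm]
    linarith
  have hb : ‖b‖ = ‖b'‖ := by
    rw [← sq_eq_sq₀ (norm_nonneg _) (norm_nonneg _), Complex.sq_norm, Complex.sq_norm]
    linarith
  have hstar : ∀ t : Circle, (t : ℂ) * star (t : ℂ) = 1 := fun t => by
    rw [Complex.star_def, Complex.mul_conj, Circle.normSq_coe, Complex.ofReal_one]
  by_cases ha0 : a = 0
  · have ha' : a' = 0 := norm_eq_zero.1 (by rw [← ha, ha0, norm_zero])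
    by_cases hb0 : b = 0
    · have hb' : b' = 0 := norm_eq_zero.1 (by rw [← hb, hb0, norm_zero])
      exact ⟨1, by simp [ha0, ha'], by simp [hb0, hb']⟩
    · have hz : ‖star (b' / b)‖ = 1 := by
        rw [norm_star, norm_div, ← hb, div_self (norm_ne_zero_iff.2 hb0)]
      refine ⟨⟨star (b' / b), mem_sphere_zero_iff_norm.2 hz⟩, by simp [ha0, ha'], ?_⟩
      change b' = star (star (b' / b)) * b
      rw [star_star, div_mul_cancel₀ _ hb0]
  · have hz : ‖a' / a‖ = 1 := by
      rw [norm_div, ← ha, div_self (norm_ne_zero_iff.2 ha0)]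
    let t : Circle := ⟨a' / a, mem_sphere_zero_iff_norm.2 hz⟩
    have hta : a' = t * a := (div_mul_cancel₀ _ ha0).symm
    refine ⟨t, hta, ?_⟩
    apply mul_left_cancel₀ ha0
    rw [hta] at h
    linear_combination (-(a * b')) * hstar t - star (t : ℂ) * h

theorem exists_sq_eq_circle (z : Circle) : ∃ μ : Circle, (μ : ℂ) * μ = z :=
  ⟨Circle.exp (Complex.arg z / 2), by
    rw [← Circle.coe_mul, ← Circle.exp_add, add_halves, Circle.exp_arg]⟩

theorem exists_mul_eq_of_normSq_sub (c : ℂ) (h : ℝ) :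
    ∃ a b : ℂ, a * b = c ∧ (Complex.normSq a - Complex.normSq b) / 2 = h := by
  set s := Real.sqrt (Complex.normSq c + h ^ 2) with hs
  have hn := Complex.normSq_nonneg c
  have hss : s * s = Complex.normSq c + h ^ 2 := Real.mul_self_sqrt (by positivity)
  have habs : |h| ≤ s := Real.abs_le_sqrt (by linarith)
  have h1 : 0 ≤ s + h := by linarith [neg_abs_le h]
  have h2 : 0 ≤ s - h := by linarith [le_abs_self h]
  refine ⟨Real.sqrt (s + h) * Complex.exp (c.arg * Complex.I), Real.sqrt (s - h), ?_, ?_⟩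
  · have h3 : Real.sqrt (s + h) * Real.sqrt (s - h) = ‖c‖ := by
      rw [← Real.sqrt_mul h1, Complex.norm_def]
      congr 1
      linear_combination hss
    calc _ = ((Real.sqrt (s + h) * Real.sqrt (s - h) : ℝ) : ℂ) *
          Complex.exp (c.arg * Complex.I) := by push_cast; ring
      _ = c := by rw [h3, Complex.norm_mul_exp_arg_mul_I]
  · rw [Complex.normSq_mul, Complex.normSq_ofReal, Complex.normSq_ofReal,
      Real.mul_self_sqrt h1, Real.mul_self_sqrt h2, Complex.normSq_eq_norm_sq,
      Complex.norm_exp_ofReal_mul_I]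
    ring

section Invariants

variable {k r : ℕ}

/-- The moment map of the circle actions `t • (a, b) = (t a, t̄ b)`. -/
noncomputable def momentMap (a b : Fin k → ℂ) : EuclideanSpace ℝ (Fin k) :=
  WithLp.toLp 2 fun j => (Complex.normSq (a j) - Complex.normSq (b j)) / 2

/-- The size of the pair consisting of `momentMap a b` and `a * b`. -/
noncomputable def invariantNorm (a b : Fin k → ℂ) : ℝ :=
  Real.sqrt (‖momentMap a b‖ ^ 2 + sqNorm (a * b))

/-- The normalized invariants of a point of the quadric. -/
noncomputable def invariantMap (a b : Fin k → ℂ) :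
    EuclideanSpace ℝ (Fin k) × Matrix (Fin k) (Fin k) ℂ :=
  ((invariantNorm a b)⁻¹ • momentMap a b,
    rankOne (((invariantNorm a b)⁻¹ : ℂ) • (a * b)))

/-- The quadric in light-cone coordinates, normalized to norm `√2`. -/
def IsQuadricPoint (a b : Fin k → ℂ) (w : Fin r → ℂ) : Prop :=
  ∑ j, a j * b j + ∑ i, w i ^ 2 = 0 ∧
    ∑ j, (Complex.normSq (a j) + Complex.normSq (b j)) / 2 + ∑ i, Complex.normSq (w i) = 2

/-- The norm of a point of the quadric as a function of its invariants. -/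
noncomputable def quadricNorm (c : Fin k → ℂ) (h : EuclideanSpace ℝ (Fin k)) : ℝ :=
  ∑ j, Real.sqrt (Complex.normSq (c j) + h j ^ 2) + ‖∑ j, c j‖

theorem quadricNorm_smul {s : ℝ} (hs : 0 ≤ s) (c : Fin k → ℂ) (h : EuclideanSpace ℝ (Fin k)) :
    quadricNorm ((s : ℂ) • c) (s • h) = s * quadricNorm c h := by
  have h1 : ∀ j, Real.sqrt (Complex.normSq (((s : ℂ) • c) j) + (s • h) j ^ 2) =
      s * Real.sqrt (Complex.normSq (c j) + h j ^ 2) := by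
    intro j
    rw [← Real.sqrt_sq hs, ← Real.sqrt_mul (sq_nonneg s), Real.sqrt_sq hs]
    congr 1
    simp
    ring
  rw [quadricNorm, quadricNorm, mul_add, Finset.mul_sum]
  congr 1
  · exact Finset.sum_congr rfl fun j _ => h1 j
  · simp [← Finset.mul_sum, abs_of_nonneg hs]

theorem quadricNorm_circle_smul (z : Circle) (c : Fin k → ℂ) (h : EuclideanSpace ℝ (Fin k)) :
    quadricNorm ((z : ℂ) • c) h = quadricNorm c h := by
  simp [quadricNorm, ← Finset.mul_sum, Circle.norm_coe]

theorem quadricNorm_mul_momentMap (a b : Fin k → ℂ) : quadricNorm (a * b) (momentMap a b) =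
    ∑ j, (Complex.normSq (a j) + Complex.normSq (b j)) / 2 + ‖∑ j, a j * b j‖ := by
  rw [quadricNorm]
  congr 1
  refine Finset.sum_congr rfl fun j _ => ?_
  have h1 := Complex.normSq_nonneg (a j)
  have h2 := Complex.normSq_nonneg (b j)
  rw [Real.sqrt_eq_iff_mul_self_eq (add_nonneg (Complex.normSq_nonneg _) (sq_nonneg _))
    (by positivity), Pi.mul_apply,
    Complex.normSq_mul, momentMap]
  simp only
  ring

theorem norm_sum_sq_of_le_one (hr : r ≤ 1) (w : Fin r → ℂ) :
    ‖∑ i, w i ^ 2‖ = ∑ i, Complex.normSq (w i) := by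
  have := Fin.subsingleton_iff_le_one.2 hr
  rcases isEmpty_or_nonempty (Fin r) with h | ⟨⟨i⟩⟩
  · simp
  · rw [Fintype.sum_subsingleton _ i, Fintype.sum_subsingleton _ i, norm_pow, Complex.sq_norm]

theorem IsQuadricPoint.quadricNorm_eq (hr : r ≤ 1) {a b : Fin k → ℂ} {w : Fin r → ℂ}
    (h : IsQuadricPoint a b w) : quadricNorm (a * b) (momentMap a b) = 2 := by
  rw [quadricNorm_mul_momentMap, eq_neg_of_add_eq_zero_left h.1, norm_neg, norm_sum_sq_of_le_one hr,
    h.2]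

theorem IsQuadricPoint.invariantNorm_pos (hr : r ≤ 1) {a b : Fin k → ℂ} {w : Fin r → ℂ}
    (h : IsQuadricPoint a b w) : 0 < invariantNorm a b := by
  have hs := sqNorm_nonneg (a * b)
  refine Real.sqrt_pos.2 (lt_of_le_of_ne (by positivity) fun h0 => ?_)
  have h1 : ‖momentMap a b‖ ^ 2 = 0 := by nlinarith [sq_nonneg ‖momentMap a b‖]
  have h2 : momentMap a b = 0 := norm_eq_zero.1 (pow_eq_zero_iff two_ne_zero |>.1 h1)
  have h3 : a * b = 0 := sqNorm_eq_zero.1 (by rw [h1, zero_add] at h0; exact h0.symm)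
  have h4 := h.quadricNorm_eq hr
  rw [h2, h3] at h4
  simp [quadricNorm] at h4

/-- Points of the quadric with the same invariants lie on the same orbit. -/
theorem IsQuadricPoint.exists_of_invariantMap_eq (hr : r ≤ 1) {a b a' b' : Fin k → ℂ}
    {w w' : Fin r → ℂ} (h : IsQuadricPoint a b w) (h' : IsQuadricPoint a' b' w')
    (heq : invariantMap a b = invariantMap a' b') :
    ∃ (t : Fin k → Circle) (μ : Circle), (∀ j, a' j = t j * (μ * a j)) ∧
      (∀ j, b' j = star (t j : ℂ) * (μ * b j)) ∧ ∀ i, w' i = μ * w i := by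
  have hρ := h.invariantNorm_pos hr
  have hρ' := h'.invariantNorm_pos hr
  have heq1 := congrArg Prod.fst heq
  have heq2 := congrArg Prod.snd heq
  simp only [invariantMap] at heq1 heq2
  obtain ⟨z, hz⟩ := rankOne_eq_iff.1 heq2
  have hz' : ((invariantNorm a' b')⁻¹ : ℂ) • (a' * b') =
    (z : ℂ) • (((invariantNorm a b)⁻¹ : ℂ) • (a * b)) := funext hz
  have hg := quadricNorm_smul (inv_nonneg.2 hρ'.le) (a' * b') (momentMap a' b')
  rw [Complex.ofReal_inv, hz', ← heq1, quadricNorm_circle_smul, h'.quadricNorm_eq hr, ← Complex.ofReal_inv,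
    quadricNorm_smul (inv_nonneg.2 hρ.le), h.quadricNorm_eq hr] at hg
  have hρρ : invariantNorm a b = invariantNorm a' b' :=
    inv_injective (mul_right_cancel₀ two_ne_zero hg)
  rw [← hρρ] at heq1 hz'
  have hm : momentMap a b = momentMap a' b' :=
    smul_right_injective _ (inv_ne_zero hρ.ne') heq1
  rw [smul_comm] at hz'
  have hc : a' * b' = (z : ℂ) • (a * b) :=
    smul_right_injective _ (inv_ne_zero (Complex.ofReal_ne_zero.2 hρ.ne')) hz'
  have hcj : ∀ j, a' j * b' j = z * (a j * b j) := fun j => congrFun hc j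
  have hw2 : ∑ i, w' i ^ 2 = z * ∑ i, w i ^ 2 := by
    have h1 := h.1
    have h2 := h'.1
    simp only [hcj, ← Finset.mul_sum] at h2
    linear_combination h2 - z * h1
  obtain ⟨μ, hμ, hμw⟩ : ∃ μ : Circle, (μ : ℂ) * μ = z ∧ ∀ i, w' i = μ * w i := by
    obtain ⟨μ, hμ⟩ := exists_sq_eq_circle z
    have := Fin.subsingleton_iff_le_one.2 hr
    rcases isEmpty_or_nonempty (Fin r) with hr0 | ⟨⟨i⟩⟩
    · exact ⟨μ, hμ, fun i => isEmptyElim i⟩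
    · rw [Fintype.sum_subsingleton _ i, Fintype.sum_subsingleton _ i, ← hμ] at hw2
      have hsq : w' i ^ 2 = (μ * w i) ^ 2 := by rw [hw2]; ring
      rcases sq_eq_sq_iff_eq_or_eq_neg.1 hsq with h1 | h1
      · exact ⟨μ, hμ, fun l => by rw [Subsingleton.elim l i, h1]⟩
      · exact ⟨-μ, by simp [hμ], fun l => by rw [Subsingleton.elim l i, h1]; simp⟩
  have ht : ∀ j, ∃ t : Circle, a' j = t * (μ * a j) ∧ b' j = star (t : ℂ) * (μ * b j) := by
    intro j
    apply exists_circle_of_mul_eq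
    · rw [hcj, ← hμ]; ring
    · have := congrFun (congrArg WithLp.ofLp hm) j
      simp only [momentMap] at this
      simp only [Complex.normSq_mul, Circle.normSq_coe, one_mul]
      linarith
  choose t ht1 ht2 using ht
  exact ⟨t, μ, ht1, ht2, hμw⟩

/-- The possible values of `a * b` on the quadric. -/
def productSubmodule (k r : ℕ) : Submodule ℂ (Fin k → ℂ) where
  carrier := {c | r = 0 → ∑ j, c j = 0}
  add_mem' hx hy h := by simp [Finset.sum_add_distrib, hx h, hy h]
  zero_mem' _ := by simp
  smul_mem' s x hx h := by simp [← Finset.mul_sum, hx h]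

theorem finrank_productSubmodule {n : ℕ} (hn : 2 ≤ n) :
    Module.finrank ℂ (productSubmodule (n / 2) (n % 2)) = (n + 1) / 2 - 1 := by
  rcases Nat.mod_two_eq_zero_or_one n with h | h
  · let f : Module.Dual ℂ (Fin (n / 2) → ℂ) := ∑ j, LinearMap.proj j
    have hf : f ≠ 0 := by
      intro h0
      have := LinearMap.congr_fun h0 (Pi.single ⟨0, by omega⟩ 1)
      simp [f] at this
    have hker : productSubmodule (n / 2) (n % 2) = LinearMap.ker f := by
      ext c
      simp [productSubmodule, h, f]
    have := Module.Dual.finrank_ker_add_one_of_ne_zero hf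
    rw [Module.finrank_fin_fun] at this
    rw [hker]
    omega
  · have : productSubmodule (n / 2) (n % 2) = ⊤ := by
      ext c
      simp [productSubmodule, h]
    rw [this, finrank_top, Module.finrank_fin_fun]
    omega

theorem IsQuadricPoint.mul_mem {a b : Fin k → ℂ} {w : Fin r → ℂ} (h : IsQuadricPoint a b w) :
    a * b ∈ productSubmodule k r := by
  rintro rfl
  simpa using h.1

theorem exists_isQuadricPoint (hr : r ≤ 1) {h : EuclideanSpace ℝ (Fin k)} {c : Fin k → ℂ}
    (hc : c ∈ productSubmodule k r) (hn : ‖h‖ ^ 2 + sqNorm c = 1) :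
    ∃ (a b : Fin k → ℂ) (w : Fin r → ℂ), IsQuadricPoint a b w ∧
      invariantMap a b = (h, rankOne c) := by
  have hpos : 0 < quadricNorm c h := by
    have h1 : ∀ j, 0 ≤ Real.sqrt (Complex.normSq (c j) + h j ^ 2) := fun j => Real.sqrt_nonneg _
    have h0 : 0 ≤ quadricNorm c h := add_nonneg (Finset.sum_nonneg fun j _ => h1 j) (norm_nonneg _)
    refine lt_of_le_of_ne h0 fun e => ?_
    have h2 : ∑ j, Real.sqrt (Complex.normSq (c j) + h j ^ 2) = 0 :=
      le_antisymm (by rw [e, quadricNorm]; exact le_add_of_nonneg_right (norm_nonneg _))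
        (Finset.sum_nonneg fun j _ => h1 j)
    have h3 : ∀ j, Complex.normSq (c j) = 0 ∧ h j ^ 2 = 0 := by
      intro j
      have h4 := (Finset.sum_eq_zero_iff_of_nonneg fun j _ => h1 j).1 h2 j (Finset.mem_univ j)
      have h5 := Complex.normSq_nonneg (c j)
      rw [Real.sqrt_eq_zero (by positivity)] at h4
      exact (add_eq_zero_iff_of_nonneg h5 (sq_nonneg _)).1 h4
    rw [EuclideanSpace.real_norm_sq_eq, sqNorm] at hn
    simp [h3] at hn
  set s := 2 / quadricNorm c h with hs
  have hs0 : 0 < s := by positivity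
  choose a b hab hmom using fun j => exists_mul_eq_of_normSq_sub (s * c j) (s * h j)
  have hprod : a * b = (s : ℂ) • c := funext hab
  have hm : momentMap a b = s • h := by ext j; exact hmom j
  obtain ⟨w, hw⟩ : ∃ w : Fin r → ℂ, ∑ j, a j * b j + ∑ i, w i ^ 2 = 0 := by
    have := Fin.subsingleton_iff_le_one.2 hr
    rcases isEmpty_or_nonempty (Fin r) with hr0 | ⟨⟨i⟩⟩
    · refine ⟨0, ?_⟩
      have hr' : r = 0 := by
        by_contra h0
        exact hr0.false ⟨0, Nat.pos_of_ne_zero h0⟩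
      simp [hab, ← Finset.mul_sum, hc hr']
    · obtain ⟨ω, hω⟩ := IsAlgClosed.exists_pow_nat_eq (-∑ j, a j * b j) two_pos
      exact ⟨fun _ => ω, by rw [Fintype.sum_subsingleton _ i, hω, add_neg_cancel]⟩
  have hquad : IsQuadricPoint a b w := by
    refine ⟨hw, ?_⟩
    rw [← norm_sum_sq_of_le_one hr, ← norm_neg, ← eq_neg_of_add_eq_zero_left hw,
      ← quadricNorm_mul_momentMap, hprod, hm, quadricNorm_smul hs0.le, hs, div_mul_cancel₀ _ hpos.ne']
  refine ⟨a, b, w, hquad, ?_⟩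
  have hρ : invariantNorm a b = s := by
    rw [invariantNorm, hm, hprod, norm_smul, sqNorm_smul, Complex.normSq_ofReal,
      Real.norm_of_nonneg hs0.le,
      show (s * ‖h‖) ^ 2 + s * s * sqNorm c = s ^ 2 * (‖h‖ ^ 2 + sqNorm c) by ring, hn, mul_one,
      Real.sqrt_sq hs0.le]
  have hs' : (s : ℂ) ≠ 0 := Complex.ofReal_ne_zero.2 hs0.ne'
  rw [invariantMap, hρ, hm, hprod, smul_smul, smul_smul, inv_mul_cancel₀ hs0.ne',
    inv_mul_cancel₀ hs', one_smul, one_smul]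

theorem IsQuadricPoint.norm_invariantMap (hr : r ≤ 1) {a b : Fin k → ℂ} {w : Fin r → ℂ}
    (h : IsQuadricPoint a b w) : ∃ c ∈ productSubmodule k r,
      (invariantMap a b).2 = rankOne c ∧ ‖(invariantMap a b).1‖ ^ 2 + sqNorm c = 1 := by
  have hρ := h.invariantNorm_pos hr
  refine ⟨_, Submodule.smul_mem _ _ h.mul_mem, rfl, ?_⟩
  have h1 : invariantNorm a b ^ 2 = ‖momentMap a b‖ ^ 2 + sqNorm (a * b) :=
    Real.sq_sqrt (by have := sqNorm_nonneg (a * b); positivity)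
  rw [invariantMap, norm_smul, sqNorm_smul, ← Complex.ofReal_inv, Complex.normSq_ofReal,
    Real.norm_of_nonneg (inv_nonneg.2 hρ.le)]
  field_simp
  exact h1.symm

theorem invariantMap_eq_of_orbit {a b a' b' : Fin k → ℂ} (t : Fin k → Circle) (μ : Circle)
    (ha : ∀ j, a' j = t j * (μ * a j)) (hb : ∀ j, b' j = star (t j : ℂ) * (μ * b j)) :
    invariantMap a b = invariantMap a' b' := by
  have hm : momentMap a' b' = momentMap a b := by
    ext j
    simp [momentMap, ha, hb]
  have hc : a' * b' = ((μ * μ : Circle) : ℂ) • (a * b) := by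
    ext j
    have ht : (t j : ℂ) * star (t j : ℂ) = 1 := by
      rw [Complex.star_def, Complex.mul_conj, Circle.normSq_coe, Complex.ofReal_one]
    simp only [Pi.mul_apply, Pi.smul_apply, smul_eq_mul, ha, hb, Circle.coe_mul]
    linear_combination (μ * μ * a j * b j : ℂ) * ht
  have hρ : invariantNorm a' b' = invariantNorm a b := by
    rw [invariantNorm, invariantNorm, hm, hc, sqNorm_smul, Circle.normSq_coe, one_mul]
  refine Prod.ext (by simp only [invariantMap, hm, hρ]) (rankOne_eq_iff.2 ⟨μ * μ, fun i => ?_⟩)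
  rw [hρ, hc, smul_comm]
  rfl

end Invariants

section Coordinates

variable {k r : ℕ}

/-- The rows of a real matrix with two columns as complex numbers. -/
def complexRow {ι : Type*} (W : Matrix ι (Fin 2) ℝ) (i : ι) : ℂ := ⟨W i 0, W i 1⟩

/-- The coordinates on which the `j`-th circle of the standard torus acts by multiplication. -/
def coordPos (W : Matrix (Fin 2 × Fin k ⊕ Fin r) (Fin 2) ℝ) (j : Fin k) : ℂ :=
  complexRow W (.inl (0, j)) + Complex.I * complexRow W (.inl (1, j))

/-- The coordinates on which the `j`-th circle of the standard torus acts by multiplication with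
the conjugate. -/
def coordNeg (W : Matrix (Fin 2 × Fin k ⊕ Fin r) (Fin 2) ℝ) (j : Fin k) : ℂ :=
  complexRow W (.inl (0, j)) - Complex.I * complexRow W (.inl (1, j))

/-- The coordinates on which the standard torus acts trivially. -/
def coordFix (W : Matrix (Fin 2 × Fin k ⊕ Fin r) (Fin 2) ℝ) (i : Fin r) : ℂ :=
  complexRow W (.inr i)

theorem transpose_mul_self_eq_one_iff {ι : Type*} [Fintype ι] {W : Matrix ι (Fin 2) ℝ} :
    Wᵀ * W = 1 ↔ ∑ i, complexRow W i ^ 2 = 0 ∧ ∑ i, Complex.normSq (complexRow W i) = 2 := by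
  have h1 : (∑ i, complexRow W i ^ 2).re = (Wᵀ * W) 0 0 - (Wᵀ * W) 1 1 := by
    simp [complexRow, mul_apply, pow_two]
  have h2 : (∑ i, complexRow W i ^ 2).im = 2 * (Wᵀ * W) 0 1 := by
    simp only [complexRow, mul_apply, pow_two, Complex.im_sum, Complex.mul_im, transpose_apply,
      Finset.mul_sum]
    exact Finset.sum_congr rfl fun i _ => by ring
  have h3 : ∑ i, Complex.normSq (complexRow W i) = (Wᵀ * W) 0 0 + (Wᵀ * W) 1 1 := by
    simp [complexRow, mul_apply, Complex.normSq_apply, Finset.sum_add_distrib]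
  have h4 : (Wᵀ * W) 1 0 = (Wᵀ * W) 0 1 := by
    simp [mul_apply, mul_comm]
  rw [Complex.ext_iff, h1, h2, h3]
  constructor
  · intro h
    rw [h]
    norm_num
  · rintro ⟨⟨e1, e2⟩, e3⟩
    simp only [Complex.zero_re, Complex.zero_im] at e1 e2
    ext i j
    fin_cases i <;> fin_cases j <;> simp [h4] <;> linarith

theorem isQuadricPoint_iff {W : Matrix (Fin 2 × Fin k ⊕ Fin r) (Fin 2) ℝ} :
    IsQuadricPoint (coordPos W) (coordNeg W) (coordFix W) ↔ Wᵀ * W = 1 := by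
  have h1 : ∀ j, coordPos W j * coordNeg W j =
      complexRow W (.inl (0, j)) ^ 2 + complexRow W (.inl (1, j)) ^ 2 := by
    intro j
    rw [coordPos, coordNeg]
    linear_combination (-(complexRow W (.inl (1, j)) ^ 2)) * Complex.I_sq
  have h2 : ∀ j, (Complex.normSq (coordPos W j) + Complex.normSq (coordNeg W j)) / 2 =
      Complex.normSq (complexRow W (.inl (0, j))) +
        Complex.normSq (complexRow W (.inl (1, j))) := by
    intro j
    simp [coordPos, coordNeg, Complex.normSq_apply]
    ring
  rw [transpose_mul_self_eq_one_iff, IsQuadricPoint]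
  simp only [h1, h2, Fintype.sum_sum_type, Fintype.sum_prod_type, Fin.sum_univ_two,
    Finset.sum_add_distrib]
  rfl

theorem exists_coord_eq (a b : Fin k → ℂ) (w : Fin r → ℂ) :
    ∃ W : Matrix (Fin 2 × Fin k ⊕ Fin r) (Fin 2) ℝ,
      coordPos W = a ∧ coordNeg W = b ∧ coordFix W = w := by
  let z : Fin 2 × Fin k ⊕ Fin r → ℂ := Sum.elim
    (fun p => ![(a p.2 + b p.2) / 2, (a p.2 - b p.2) / (2 * Complex.I)] p.1) w
  let W : Matrix (Fin 2 × Fin k ⊕ Fin r) (Fin 2) ℝ := Matrix.of fun i => ![(z i).re, (z i).im]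
  have hz : ∀ i, complexRow W i = z i := fun i => Complex.ext rfl rfl
  have hI := Complex.I_ne_zero
  refine ⟨W, ?_, ?_, ?_⟩
  · ext j
    simp only [coordPos, hz, z, Sum.elim_inl, Matrix.cons_val_zero, Matrix.cons_val_one]
    field_simp
    ring
  · ext j
    simp only [coordNeg, hz, z, Sum.elim_inl, Matrix.cons_val_zero, Matrix.cons_val_one]
    field_simp
    ring
  · ext j
    simp only [coordFix, hz, z, Sum.elim_inr]

theorem eq_of_coord_eq {W W' : Matrix (Fin 2 × Fin k ⊕ Fin r) (Fin 2) ℝ}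
    (h1 : coordPos W = coordPos W') (h2 : coordNeg W = coordNeg W')
    (h3 : coordFix W = coordFix W') : W = W' := by
  have h : ∀ i, complexRow W i = complexRow W' i := by
    rintro (⟨i, j⟩ | i)
    · have e1 := congrFun h1 j
      have e2 := congrFun h2 j
      simp only [coordPos, coordNeg] at e1 e2
      fin_cases i
      · change complexRow W (.inl (0, j)) = complexRow W' (.inl (0, j))
        linear_combination (e1 + e2) / 2
      · change complexRow W (.inl (1, j)) = complexRow W' (.inl (1, j))
        apply mul_left_cancel₀ Complex.I_ne_zero
        linear_combination (e1 - e2) / 2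
    · exact congrFun h3 i
  ext i l
  fin_cases l
  · exact congrArg Complex.re (h i)
  · exact congrArg Complex.im (h i)

theorem complexRow_mul_rotationMatrix_transpose {ι : Type*} (W : Matrix ι (Fin 2) ℝ) (μ : Circle)
    (i : ι) : complexRow (W * (rotationMatrix μ)ᵀ) i = μ * complexRow W i := by
  apply Complex.ext <;> simp [complexRow, mul_apply, rotationMatrix] <;> ring

theorem coord_rotate (W : Matrix (Fin 2 × Fin k ⊕ Fin r) (Fin 2) ℝ) (t : Fin k → Circle)
    (μ : Circle) :
    (∀ j, coordPos (torusMatrix r t * W * (rotationMatrix μ)ᵀ) j = t j * (μ * coordPos W j)) ∧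
    (∀ j, coordNeg (torusMatrix r t * W * (rotationMatrix μ)ᵀ) j =
      star (t j : ℂ) * (μ * coordNeg W j)) ∧
    ∀ i, coordFix (torusMatrix r t * W * (rotationMatrix μ)ᵀ) i = μ * coordFix W i := by
  have h0 : ∀ j, complexRow (torusMatrix r t * W) (.inl (0, j)) =
      (t j : ℂ).re * complexRow W (.inl (0, j)) - (t j : ℂ).im * complexRow W (.inl (1, j)) := by
    intro j
    apply Complex.ext <;>
    simp [complexRow, mul_apply, torusMatrix, Fintype.sum_sum_type, Fintype.sum_prod_type,
      blockDiagonal_apply, rotationMatrix] <;> ring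
  have h1 : ∀ j, complexRow (torusMatrix r t * W) (.inl (1, j)) =
      (t j : ℂ).im * complexRow W (.inl (0, j)) + (t j : ℂ).re * complexRow W (.inl (1, j)) := by
    intro j
    apply Complex.ext <;>
    simp [complexRow, mul_apply, torusMatrix, Fintype.sum_sum_type, Fintype.sum_prod_type,
      blockDiagonal_apply, rotationMatrix]
  have h2 : ∀ i, complexRow (torusMatrix r t * W) (.inr i) = complexRow W (.inr i) := by
    intro i
    apply Complex.ext <;>
    simp [complexRow, mul_apply, torusMatrix, Fintype.sum_sum_type, Matrix.one_apply]
  have ht : ∀ j, (t j : ℂ) = (t j : ℂ).re + (t j : ℂ).im * Complex.I := fun j =>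
    (Complex.re_add_im _).symm
  have ht' : ∀ j, star (t j : ℂ) = (t j : ℂ).re - (t j : ℂ).im * Complex.I := fun j => by
    apply Complex.ext <;> simp
  refine ⟨fun j => ?_, fun j => ?_, fun i => ?_⟩
  · simp only [coordPos, complexRow_mul_rotationMatrix_transpose, h0, h1]
    conv_rhs => rw [ht j]
    linear_combination (-(μ * (t j : ℂ).im * complexRow W (.inl (1, j)))) * Complex.I_sq
  · simp only [coordNeg, complexRow_mul_rotationMatrix_transpose, h0, h1]
    conv_rhs => rw [ht' j]
    linear_combination (-(μ * (t j : ℂ).im * complexRow W (.inl (1, j)))) * Complex.I_sq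
  · simp only [coordFix, complexRow_mul_rotationMatrix_transpose, h2]

theorem continuous_complexRow {ι : Type*} (i : ι) :
    Continuous fun W : Matrix ι (Fin 2) ℝ => complexRow W i := by
  have : (fun W : Matrix ι (Fin 2) ℝ => complexRow W i) =
      fun W => (W i 0 : ℂ) + (W i 1 : ℂ) * Complex.I := by
    ext W
    apply Complex.ext <;> simp [complexRow]
  rw [this]
  have h : ∀ l, Continuous fun W : Matrix ι (Fin 2) ℝ => W i l := fun l =>
    continuous_id.matrix_elem i l
  exact (Complex.continuous_ofReal.comp (h 0)).add
    ((Complex.continuous_ofReal.comp (h 1)).mul continuous_const)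

theorem continuous_coordPos :
    Continuous (coordPos : Matrix (Fin 2 × Fin k ⊕ Fin r) (Fin 2) ℝ → _) :=
  continuous_pi fun _ => (continuous_complexRow _).add
    (continuous_const.mul (continuous_complexRow _))

theorem continuous_coordNeg :
    Continuous (coordNeg : Matrix (Fin 2 × Fin k ⊕ Fin r) (Fin 2) ℝ → _) :=
  continuous_pi fun _ => (continuous_complexRow _).sub
    (continuous_const.mul (continuous_complexRow _))

end Coordinates

theorem rotationMatrix_transpose_mem (μ : Circle) :
    (rotationMatrix μ)ᵀ ∈ specialOrthogonalGroup (Fin 2) ℝ := by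
  rw [mem_specialOrthogonalGroup_fin_two_iff]
  have := circle_re_mul_self_add μ
  simp [rotationMatrix]
  linarith

theorem exists_eq_rotationMatrix_transpose {Q : Matrix (Fin 2) (Fin 2) ℝ}
    (hQ : Q ∈ specialOrthogonalGroup (Fin 2) ℝ) : ∃ μ : Circle, Q = (rotationMatrix μ)ᵀ := by
  obtain ⟨h1, h2, h3⟩ := mem_specialOrthogonalGroup_fin_two_iff.1 hQ
  have hz : ‖(⟨Q 0 0, Q 0 1⟩ : ℂ)‖ = 1 := by
    rw [← sq_eq_sq₀ (norm_nonneg _) zero_le_one, Complex.sq_norm, Complex.normSq_mk]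
    linarith
  refine ⟨⟨⟨Q 0 0, Q 0 1⟩, mem_sphere_zero_iff_norm.2 hz⟩, ?_⟩
  ext i j
  fin_cases i <;> fin_cases j <;> simp [rotationMatrix, h1, h2]

instance (n : ℕ) : CompactSpace (OrthonormalPair n) := by
  have hclosed : IsClosed {V : Matrix (Fin n) (Fin 2) ℝ | Vᵀ * V = 1} :=
    isClosed_eq (continuous_id.matrix_transpose.matrix_mul continuous_id) continuous_const
  have hK : IsCompact (Set.univ.pi fun _ : Fin n => Set.univ.pi fun _ : Fin 2 =>
      Set.Icc (-1 : ℝ) 1) :=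
    isCompact_univ_pi fun _ => isCompact_univ_pi fun _ => isCompact_Icc
  refine isCompact_iff_compactSpace.1 (hK.of_isClosed_subset hclosed ?_)
  intro (V : Matrix (Fin n) (Fin 2) ℝ) (hV : Vᵀ * V = 1) i _ l _
  have h : ∑ x, V x l * V x l = 1 := by
    have h0 : (Vᵀ * V) l l = (1 : Matrix (Fin 2) (Fin 2) ℝ) l l := congrFun (congrFun hV l) l
    rw [mul_apply, one_apply_eq] at h0
    exact h0
  have h' : V i l * V i l ≤ 1 := by
    rw [← h]
    exact Finset.single_le_sum (f := fun x => V x l * V x l) (fun x _ => mul_self_nonneg _)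
      (Finset.mem_univ i)
  exact abs_le.1 (abs_le_one_iff_mul_self_le_one.2 h')

/-- Compact spaces mapped continuously and injectively onto the same subset of a Hausdorff space
are homeomorphic. -/
theorem nonempty_homeomorph_of_range_eq {A B Z : Type*} [TopologicalSpace A] [TopologicalSpace B]
    [TopologicalSpace Z] [CompactSpace A] [CompactSpace B] [T2Space Z] {f : A → Z} {g : B → Z}
    (hf : Continuous f) (hfi : Function.Injective f) (hg : Continuous g)
    (hgi : Function.Injective g) (h : Set.range f = Set.range g) : Nonempty (A ≃ₜ B) :=
  ⟨(hf.isClosedEmbedding hfi).isEmbedding.toHomeomorph.trans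
    ((Homeomorph.setCongr h).trans (hg.isClosedEmbedding hgi).isEmbedding.toHomeomorph.symm)⟩

section PairInvariant

variable {n k r : ℕ} (g : Matrix (Fin n) (Fin 2 × Fin k ⊕ Fin r) ℝ)

/-- The invariants of an orthonormal pair with respect to the orthonormal basis `g`. -/
noncomputable def pairInvariant (V : OrthonormalPair n) :
    EuclideanSpace ℝ (Fin k) × Matrix (Fin k) (Fin k) ℂ :=
  invariantMap (coordPos (gᵀ * V.1)) (coordNeg (gᵀ * V.1))

variable {g}

theorem isQuadricPoint_coord (hg' : g * gᵀ = 1) (V : OrthonormalPair n) :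
    IsQuadricPoint (coordPos (gᵀ * V.1)) (coordNeg (gᵀ * V.1)) (coordFix (gᵀ * V.1)) := by
  rw [isQuadricPoint_iff, transpose_mul, transpose_transpose, Matrix.mul_assoc,
    ← Matrix.mul_assoc g, hg', Matrix.one_mul, V.2]

theorem continuous_pairInvariant (hr : r ≤ 1) (hg' : g * gᵀ = 1) :
    Continuous (pairInvariant g) := by
  have hV : Continuous fun V : OrthonormalPair n => gᵀ * V.1 :=
    continuous_const.matrix_mul continuous_subtype_val
  have ha := continuous_coordPos.comp hV
  have hb := continuous_coordNeg.comp hV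
  have hm : Continuous fun V : OrthonormalPair n =>
      momentMap (coordPos (gᵀ * V.1)) (coordNeg (gᵀ * V.1)) := by
    refine (PiLp.continuous_toLp 2 _).comp (continuous_pi fun j => ?_)
    exact ((Complex.continuous_normSq.comp ((continuous_apply j).comp ha)).sub
      (Complex.continuous_normSq.comp ((continuous_apply j).comp hb))).div_const 2
  have hρ : Continuous fun V : OrthonormalPair n =>
      invariantNorm (coordPos (gᵀ * V.1)) (coordNeg (gᵀ * V.1)) :=
    Real.continuous_sqrt.comp ((hm.norm.pow 2).add (continuous_sqNorm.comp (ha.mul hb)))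
  have hρ' := hρ.inv₀ fun V => ((isQuadricPoint_coord hg' V).invariantNorm_pos hr).ne'
  have hρc : Continuous fun V : OrthonormalPair n =>
      (invariantNorm (coordPos (gᵀ * V.1)) (coordNeg (gᵀ * V.1)) : ℂ)⁻¹ := by
    simpa [Function.comp_def] using Complex.continuous_ofReal.comp hρ'
  have hab : Continuous fun V : OrthonormalPair n =>
      coordPos (gᵀ * V.1) * coordNeg (gᵀ * V.1) := ha.mul hb
  exact (hρ'.smul hm).prodMk (continuous_rankOne.comp (hρc.smul hab))

theorem pairInvariant_eq_iff (hr : r ≤ 1) (hg : gᵀ * g = 1) (hg' : g * gᵀ = 1)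
    (V V' : OrthonormalPair n) : pairInvariant g V = pairInvariant g V' ↔
      ∃ (t : Fin k → Circle) (μ : Circle),
        V'.1 = (g * torusMatrix r t * gᵀ) * V.1 * (rotationMatrix μ)ᵀ := by
  constructor
  · intro h
    obtain ⟨t, μ, h1, h2, h3⟩ := (isQuadricPoint_coord hg' V).exists_of_invariantMap_eq hr
      (isQuadricPoint_coord hg' V') h
    obtain ⟨e1, e2, e3⟩ := coord_rotate (gᵀ * V.1) t μ
    have hW : gᵀ * V'.1 = torusMatrix r t * (gᵀ * V.1) * (rotationMatrix μ)ᵀ :=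
      eq_of_coord_eq (funext fun j => by rw [h1, e1]) (funext fun j => by rw [h2, e2])
        (funext fun j => by rw [h3, e3])
    refine ⟨t, μ, ?_⟩
    have : V'.1 = g * (gᵀ * V'.1) := by rw [← Matrix.mul_assoc, hg', Matrix.one_mul]
    rw [this, hW]
    simp only [Matrix.mul_assoc]
  · rintro ⟨t, μ, h⟩
    have hW : gᵀ * V'.1 = torusMatrix r t * (gᵀ * V.1) * (rotationMatrix μ)ᵀ := by
      rw [h]
      simp only [Matrix.mul_assoc]
      rw [← Matrix.mul_assoc gᵀ g, hg, Matrix.one_mul]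
    obtain ⟨e1, e2, -⟩ := coord_rotate (gᵀ * V.1) t μ
    rw [pairInvariant, pairInvariant, hW]
    exact invariantMap_eq_of_orbit t μ e1 e2

theorem range_pairInvariant (hr : r ≤ 1) (hg : gᵀ * g = 1) (hg' : g * gᵀ = 1) :
    Set.range (pairInvariant g) =
      {p | ∃ c ∈ productSubmodule k r, p.2 = rankOne c ∧ ‖p.1‖ ^ 2 + sqNorm c = 1} := by
  ext ⟨x, m⟩
  constructor
  · rintro ⟨V, hV⟩
    rw [← hV]
    exact (isQuadricPoint_coord hg' V).norm_invariantMap hr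
  · rintro ⟨c, hc, hm, h⟩
    simp only at hm h
    subst hm
    obtain ⟨a, b, w, hq, heq⟩ := exists_isQuadricPoint hr hc h
    obtain ⟨W, rfl, rfl, rfl⟩ := exists_coord_eq a b w
    have hW := isQuadricPoint_iff.1 hq
    have hgW : gᵀ * (g * W) = W := by rw [← Matrix.mul_assoc, hg, Matrix.one_mul]
    refine ⟨⟨g * W, by rw [transpose_mul, Matrix.mul_assoc, hgW, hW]⟩, ?_⟩
    change invariantMap (coordPos (gᵀ * (g * W))) (coordNeg (gᵀ * (g * W))) = _
    rw [hgW, heq]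

end PairInvariant

/-- `S^{⌊n/2⌋-1}` is the unit sphere of `ℝ^{⌊n/2⌋}`, and `ℂℙ^{⌈n/2⌉-2}` is the space of lines in
`ℂ^{⌈n/2⌉-1}`, where `⌈n/2⌉ = (n + 1) / 2` in `ℕ`. -/
theorem mainTheorem1 (n : ℕ) (hn : 2 ≤ n)
    (T : Subgroup (Matrix.specialOrthogonalGroup (Fin n) ℝ)) (hT : IsMaximalTorus T) :
    Nonempty
      (MulAction.orbitRel.Quotient T (OrientedGrassmannian n) ≃ₜ
        Join (Metric.sphere (0 : EuclideanSpace ℝ (Fin (n / 2))) 1)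
          (ComplexProjectiveSpace ((n + 1) / 2 - 1))) := by
  obtain ⟨g, hg, hg', rfl⟩ := hT.exists_eq_range_torusHom
  have hr : n % 2 ≤ 1 := by omega
  have hplane : ∀ V W, (sameOrientedPlane n).r V W → pairInvariant g V = pairInvariant g W := by
    rintro V W ⟨Q, hQ, h⟩
    obtain ⟨μ, rfl⟩ := exists_eq_rotationMatrix_transpose hQ
    refine (pairInvariant_eq_iff hr hg hg' V W).2 ⟨1, μ, ?_⟩
    rw [torusMatrix_one, Matrix.mul_one, hg', Matrix.one_mul, h]
  let F : OrientedGrassmannian n → EuclideanSpace ℝ (Fin (n / 2)) × Matrix _ _ ℂ :=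
    Quotient.lift (pairInvariant g) hplane
  have hF : Continuous F := (continuous_pairInvariant hr hg').quotient_lift hplane
  have horbit : ∀ x y, MulAction.orbitRel (torusHom g hg hg').range (OrientedGrassmannian n) x y →
      F x = F y := by
    rintro _ ⟨W⟩ ⟨⟨_, t, rfl⟩, rfl⟩
    refine ((pairInvariant_eq_iff hr hg hg' W _).2 ⟨t, 1, ?_⟩).symm
    rw [rotationMatrix_one, transpose_one, Matrix.mul_one]
    rfl
  let f : MulAction.orbitRel.Quotient (torusHom g hg hg').range (OrientedGrassmannian n) →
      EuclideanSpace ℝ (Fin (n / 2)) × Matrix _ _ ℂ := Quotient.lift F horbit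
  have hf : Continuous f := hF.quotient_lift horbit
  have hfi : Function.Injective f := by
    rintro ⟨⟨V⟩⟩ ⟨⟨W⟩⟩ h
    obtain ⟨t, μ, h⟩ := (pairInvariant_eq_iff hr hg hg' W V).1 h.symm
    refine Quotient.sound ⟨⟨torusHom g hg hg' t, t, rfl⟩, Quotient.sound ?_⟩
    exact ⟨_, rotationMatrix_transpose_mem μ, h⟩
  have hrange : Set.range f = Set.range (pairInvariant g) := by
    ext p
    constructor
    · rintro ⟨⟨⟨V⟩⟩, rfl⟩
      exact ⟨V, rfl⟩
    · rintro ⟨V, rfl⟩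
      exact ⟨Quotient.mk _ (Quotient.mk _ V), rfl⟩
  have : CompactSpace (OrientedGrassmannian n) :=
    inferInstanceAs (CompactSpace (Quotient (sameOrientedPlane n)))
  let L : (Fin ((n + 1) / 2 - 1) → ℂ) ≃ₗ[ℂ] productSubmodule (n / 2) (n % 2) :=
    LinearEquiv.ofFinrankEq _ _ (by rw [finrank_productSubmodule hn, Module.finrank_fin_fun])
  refine nonempty_homeomorph_of_range_eq hf hfi (continuous_joinMap (continuous_projectiveMap L))
    (joinMap_injective (projectiveMap_injective L)) ?_
  rw [hrange, range_pairInvariant hr hg hg', range_joinMap_projectiveMap]
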